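/- Let $g_{11}, g_{22}, g_{12} \in \mathbb{R}$, $\kappa \ge 0$ and $\gamma \ge 0$, and consider on $\mathbb{R}$ the coupled nonlinear Schrödinger system $$ \begin{aligned} i u_t &= -u_{xx} + \kappa v + i\gamma u - (g_{11}|u|^2 + g_{12}|v|^2)\,u,\\ i v_t &= -v_{xx} + \kappa u - i\gamma v - (g_{12}|u|^2 + g_{22}|v|^2)\,v \end{aligned} $$ for complex-valued functions $u(t,x)$, $v(t,x)$. A global solution is a pair $(u,v) \in C(\mathbb{R}, H^1(\mathbb{R}) \times H^1(\mathbb{R}))$ such that $u$ and $v$ are differentiable in $t$ with values in $H^{-1}(\mathbb{R})$ and both equations hold in $H^{-1}(\mathbb{R})$ for every $t \in \mathbb{R}$. (1) For every $(u_0,v_0) \in H^1(\mathbb{R}) \times H^1(\mathbb{R})$ there exists a unique global solution $(u,v)$ with $(u(0),v(0)) = (u_0,v_0)$. (2) The $H^1$ norm grows at most exponentially: there is a constant $a \ge 0$, depending only on $\kappa, \gamma, g_{11}, g_{22}, g_{12}$, such that for every global solution $(u,v)$ there is a constant $C$ with $$\|u(t)\|_{H^1} + \|v(t)\|_{H^1}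 \le C e^{a|t|} \qquad \text{for all } t \in \mathbb{R}.$$ -/

import Mathlib

open MeasureTheory
open scoped SchwartzMap ENNReal

noncomputable section

namespace PTNLS

/-- The complex space `L²(ℝ)`. -/
abbrev L2 : Type := Lp ℂ 2 (volume : Measure ℝ)

/-- The Sobolev space `H¹(ℝ)` of complex-valued functions, realized as the space of pairs `(f, f')`
in `L²(ℝ) × L²(ℝ)` for which `f'` is the distributional derivative of `f`, with the norm
`‖f‖²_{H¹} = ‖f‖²_{L²} + ‖f'‖²_{L²}`. The second component is determined by the first one. -/
def sobolevH1 : Submodule ℂ (WithLp 2 (L2 × L2)) where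
  carrier := {p | TemperedDistribution.derivCLM ℂ (p.fst : 𝓢'(ℝ, ℂ)) = (p.snd : 𝓢'(ℝ, ℂ))}
  zero_mem' := by
    simp [← Lp.toTemperedDistributionCLM_apply]
  add_mem' := by
    intro p q hp hq
    simp only [Set.mem_ofPred_eq, ← Lp.toTemperedDistributionCLM_apply] at hp hq ⊢
    rw [WithLp.add_fst, WithLp.add_snd, map_add, map_add, map_add, hp, hq]
  smul_mem' := by
    intro c p hp
    simp only [Set.mem_ofPred_eq, ← Lp.toTemperedDistributionCLM_apply] at hp ⊢
    rw [WithLp.smul_fst, WithLp.smul_snd, map_smul, map_smul, map_smul, hp]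

/-- `H¹(ℝ)` as a type; its inner product and norm are those inherited from `L²(ℝ) × L²(ℝ)`. -/
def H1 : Type := sobolevH1

instance : NormedAddCommGroup H1 := inferInstanceAs (NormedAddCommGroup sobolevH1)

instance : InnerProductSpace ℂ H1 := inferInstanceAs (InnerProductSpace ℂ sobolevH1)

/-- The inclusion `H¹(ℝ) → L²(ℝ)`. -/
def toL2 : H1 →L[ℂ] L2 :=
  (WithLp.fstL 2 ℂ L2 L2 ∘L sobolevH1.subtypeL : sobolevH1 →L[ℂ] L2)

/-- The distributional derivative `H¹(ℝ) → L²(ℝ)`. -/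
def dx : H1 →L[ℂ] L2 :=
  (WithLp.sndL 2 ℂ L2 L2 ∘L sobolevH1.subtypeL : sobolevH1 →L[ℂ] L2)

/-- The space `H⁻¹(ℝ)`, the dual of `H¹(ℝ)` with the dual norm. -/
abbrev HNeg1 : Type := StrongDual ℂ H1

/-- The (bilinear) embedding of `H¹(ℝ)` into `H⁻¹(ℝ)`, `f ↦ (φ ↦ ∫ f φ)`. -/
def toHNeg1 (f : H1) : HNeg1 :=
  (ContinuousLinearMap.mul ℂ ℂ).lpPairing volume 2 2 (toL2 f) ∘L toL2

theorem toHNeg1_apply (f φ : H1) : toHNeg1 f φ = ∫ x, toL2 f x * toL2 φ x := by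
  simp [toHNeg1, ContinuousLinearMap.lpPairing_eq_integral]

/-- The value at `φ` of the element `-u_xx + κ v + i γ u - (a |u|² + b |v|²) u` of `H⁻¹(ℝ)`.
All integrands are integrable, since functions in `H¹(ℝ)` are bounded and square integrable. -/
def rhs (κ γ a b : ℝ) (u v φ : H1) : ℂ :=
  (∫ x, dx u x * dx φ x)
    + (κ : ℂ) * (∫ x, toL2 v x * toL2 φ x)
    + Complex.I * (γ : ℂ) * (∫ x, toL2 u x * toL2 φ x)
    - ∫ x, ((a * ‖toL2 u x‖ ^ 2 + b * ‖toL2 v x‖ ^ 2 : ℝ) : ℂ) * toL2 u x * toL2 φ x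

/-- A function `w = (u, v) ∈ C(ℝ, H¹ × H¹)` is a global solution of the system
`i u_t = -u_xx + κ v + i γ u - (g₁₁ |u|² + g₁₂ |v|²) u`,
`i v_t = -v_xx + κ u - i γ v - (g₁₂ |u|² + g₂₂ |v|²) v`
if `u` and `v` are differentiable in time with values in `H⁻¹(ℝ)` and both equations hold
in `H⁻¹(ℝ)` at every time. -/
structure IsGlobalSolution (κ γ g₁₁ g₂₂ g₁₂ : ℝ) (w : C(ℝ, H1 × H1)) : Prop where
  eq_u : ∀ t : ℝ, ∃ ut : HNeg1, HasDerivAt (fun s => toHNeg1 (w s).1) ut t ∧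
    ∀ φ : H1, Complex.I * ut φ = rhs κ γ g₁₁ g₁₂ (w t).1 (w t).2 φ
  eq_v : ∀ t : ℝ, ∃ vt : HNeg1, HasDerivAt (fun s => toHNeg1 (w s).2) vt t ∧
    ∀ φ : H1, Complex.I * vt φ = rhs κ (-γ) g₂₂ g₁₂ (w t).2 (w t).1 φ

end PTNLS

end

/-! ### The space H¹: completeness, Fourier description, density of Schwartz functions. -/

noncomputable section

namespace PTNLS

open FourierTransform Real

/-! Write the system as w_t = i w_xx + F(w), with F of order zero, and let S(t) be the group
generated by i ∂ₓ². The inequality |f|² ≤ 2 ‖f‖ ‖f'‖ (`H1.ae_norm_sq_le`) makes H¹ an algebra, so F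
is locally Lipschitz on H¹ × H¹. Since S(t) is isometric on H¹, the interaction picture z = S(-t) w
turns the system into the ordinary differential equation z' = S(-t) F(S(t) z), whose field is
locally Lipschitz uniformly in t. Global existence then needs only an a priori bound
(`exists_global_solution`).

Gain and loss destroy the conservation laws, but a modified energy survives. Let M be the mass, K
the kinetic energy, P the quartic energy, G = |g₁₁| + |g₂₂| + |g₁₂|, and E = M + K - P + (2G² + 1)
M³. The sup bound gives P ≤ 2G M^(3/2) K^(1/2), so Young's inequality yields E ≥ M + K/2 + M³
(`le_energy`). In E' the terms pairing derivatives with the nonlinearity cancel between K' and P'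
(`re_dform_conj_field`, `re_schrodingerOp_conj_mul`), and the κ-terms cancel in M' and in K'. What
remains is bounded by multiples of M, K, M³ and M^(3/2) K^(1/2), hence |E'| ≤ const · E
(`hasDerivAt_energy`). Because this bound is linear in E, Grönwall gives exponential growth in both
time directions.

Uniqueness is an L² argument valid for every solution in the H⁻¹ sense (`solution_unique`): i ∂ₓ² is
skew and drops out of the derivative of the squared L² distance, and F is Lipschitz in L² on
H¹-bounded sets. Hence each global solution is the one built in the interaction picture and inherits
its bound; the energy need only be differentiated along that one. -/

/-- An element of `H¹` from a function and its distributional derivative. -/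
def H1.mk (a b : L2) (h : TemperedDistribution.derivCLM ℂ (a : 𝓢'(ℝ, ℂ)) = (b : 𝓢'(ℝ, ℂ))) : H1 :=
  (⟨WithLp.toLp 2 (a, b), h⟩ : sobolevH1)

@[simp] theorem toL2_mk (a b : L2) (h) : toL2 (H1.mk a b h) = a := rfl

@[simp] theorem dx_mk (a b : L2) (h) : dx (H1.mk a b h) = b := rfl

theorem H1.deriv_eq (f : H1) :
    TemperedDistribution.derivCLM ℂ (toL2 f : 𝓢'(ℝ, ℂ)) = (dx f : 𝓢'(ℝ, ℂ)) :=
  (f : sobolevH1).2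

theorem H1.ext' {f g : H1} (h₁ : toL2 f = toL2 g) (h₂ : dx f = dx g) : f = g := by
  apply Subtype.ext (p := fun x => x ∈ sobolevH1)
  apply (WithLp.equiv 2 (L2 × L2)).injective
  exact Prod.ext h₁ h₂

theorem L2.ext_distribution {a b : L2} (h : (a : 𝓢'(ℝ, ℂ)) = (b : 𝓢'(ℝ, ℂ))) : a = b := by
  have := LinearMap.ker_eq_bot.1
    (Lp.ker_toTemperedDistributionCLM_eq_bot (E := ℝ) (F := ℂ) (μ := volume) (p := 2))
  exact this h

/-- A function determines its distributional derivative. Identities in H¹ may thus be checked almost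
everywhere on the functions alone. -/
theorem toL2_injective : Function.Injective toL2 := fun f g h =>
  H1.ext' h (L2.ext_distribution (by rw [← H1.deriv_eq, ← H1.deriv_eq, h]))

theorem H1.ext {f g : H1} (h : toL2 f =ᵐ[volume] toL2 g) : f = g :=
  toL2_injective (Lp.ext h)

theorem H1.inner_eq (f g : H1) :
    inner ℂ f g = inner ℂ (toL2 f) (toL2 g) + inner ℂ (dx f) (dx g) :=
  WithLp.prod_inner_apply (𝕜 := ℂ) (E := L2) (F := L2) _ _

theorem H1.norm_sq_eq (f : H1) : ‖f‖ ^ 2 = ‖toL2 f‖ ^ 2 + ‖dx f‖ ^ 2 :=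
  WithLp.prod_norm_sq_eq_of_L2 (f : sobolevH1).1

theorem norm_toL2_le (f : H1) : ‖toL2 f‖ ≤ ‖f‖ := by
  have := H1.norm_sq_eq f
  nlinarith [norm_nonneg f, norm_nonneg (toL2 f), sq_nonneg ‖dx f‖]

theorem norm_dx_le (f : H1) : ‖dx f‖ ≤ ‖f‖ := by
  have := H1.norm_sq_eq f
  nlinarith [norm_nonneg f, norm_nonneg (dx f), sq_nonneg ‖toL2 f‖]

theorem H1.norm_le_add (f : H1) : ‖f‖ ≤ ‖toL2 f‖ + ‖dx f‖ := by
  have := H1.norm_sq_eq f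
  nlinarith [norm_nonneg f, norm_nonneg (dx f), norm_nonneg (toL2 f)]

/-- Being an element of `H¹` is a closed condition. -/
theorem isClosed_deriv_eq {X : Type*} [TopologicalSpace X] {a b : X → L2} (ha : Continuous a)
    (hb : Continuous b) :
    IsClosed {x | TemperedDistribution.derivCLM ℂ (a x : 𝓢'(ℝ, ℂ)) = (b x : 𝓢'(ℝ, ℂ))} := by
  simp_rw [← Lp.toTemperedDistributionCLM_apply]
  apply isClosed_eq <;> fun_prop

theorem isClosed_sobolevH1 : IsClosed (sobolevH1 : Set (WithLp 2 (L2 × L2))) :=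
  isClosed_deriv_eq (WithLp.fstL 2 ℂ L2 L2).continuous (WithLp.sndL 2 ℂ L2 L2).continuous

instance : CompleteSpace H1 :=
  haveI : IsClosed (sobolevH1 : Set (WithLp 2 (L2 × L2))) := isClosed_sobolevH1
  inferInstanceAs (CompleteSpace sobolevH1)

/-- The inclusion of Schwartz functions into `H¹`. -/
def H1.ofSchwartz (φ : 𝓢(ℝ, ℂ)) : H1 :=
  H1.mk (φ.toLp 2) ((SchwartzMap.derivCLM ℂ ℂ φ).toLp 2) (by
    rw [Lp.toTemperedDistribution_toLp_eq, Lp.toTemperedDistribution_toLp_eq,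
      TemperedDistribution.derivCLM_toTemperedDistributionCLM_eq ℂ])

theorem toL2_ofSchwartz (φ : 𝓢(ℝ, ℂ)) : toL2 (H1.ofSchwartz φ) = φ.toLp 2 := rfl

theorem dx_ofSchwartz (φ : 𝓢(ℝ, ℂ)) :
    dx (H1.ofSchwartz φ) = (SchwartzMap.derivCLM ℂ ℂ φ).toLp 2 := rfl

theorem derivCLM_eq_lineDeriv (f : 𝓢'(ℝ, ℂ)) :
    TemperedDistribution.derivCLM ℂ f = LineDeriv.lineDerivOp (1 : ℝ) f := by
  ext φ
  rw [TemperedDistribution.derivCLM_apply_apply, TemperedDistribution.lineDerivOp_apply_apply]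
  congr 2

theorem fourier_derivCLM (f : 𝓢'(ℝ, ℂ)) (φ : 𝓢(ℝ, ℂ)) :
    𝓕 (TemperedDistribution.derivCLM ℂ f) φ
      = 𝓕 f (SchwartzMap.smulLeftCLM ℂ (fun ξ : ℝ => (2 * π * Complex.I * ξ : ℂ)) φ) := by
  have h1 : (fun ξ : ℝ => ((inner ℝ ξ (1:ℝ) : ℝ) : ℂ)).HasTemperateGrowth := by fun_prop
  have h0 : (inner ℝ · (1:ℝ) : ℝ → ℝ).HasTemperateGrowth := by fun_prop
  rw [derivCLM_eq_lineDeriv, TemperedDistribution.fourier_lineDerivOp_eq]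
  have : (fun ξ : ℝ => (2 * π * Complex.I * ξ : ℂ))
      = (2 * π * Complex.I : ℂ) • (fun ξ : ℝ => ((inner ℝ ξ (1:ℝ) : ℝ) : ℂ)) := by
    ext ξ; simp
  rw [this, SchwartzMap.smulLeftCLM_smul h1]
  simp

theorem L2.locallyIntegrable (a : L2) : LocallyIntegrable a volume :=
  (Lp.memLp a).locallyIntegrable (by norm_num)

theorem hasTemperateGrowth_symbol :
    (fun ξ : ℝ => (2 * π * Complex.I * ξ : ℂ)).HasTemperateGrowth := by fun_prop

/-- `b` is the distributional derivative of `a` iff `𝓕 b = 2πiξ 𝓕 a`. -/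
theorem deriv_eq_iff_fourier (a b : L2) :
    TemperedDistribution.derivCLM ℂ (a : 𝓢'(ℝ, ℂ)) = (b : 𝓢'(ℝ, ℂ)) ↔
      ∀ᵐ ξ : ℝ, (𝓕 b : L2) ξ = 2 * π * Complex.I * ξ * (𝓕 a : L2) ξ := by
  have key (φ : 𝓢(ℝ, ℂ)) : 𝓕 (TemperedDistribution.derivCLM ℂ (a : 𝓢'(ℝ, ℂ))) φ
      = ∫ ξ, φ ξ * (2 * π * Complex.I * ξ * (𝓕 a : L2) ξ) := by
    rw [fourier_derivCLM, Lp.fourier_toTemperedDistribution_eq, Lp.toTemperedDistribution_apply]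
    congr 1 with ξ
    rw [SchwartzMap.smulLeftCLM_apply_apply hasTemperateGrowth_symbol]
    simp only [smul_eq_mul]; ring
  have key2 (φ : 𝓢(ℝ, ℂ)) : 𝓕 (b : 𝓢'(ℝ, ℂ)) φ = ∫ ξ, φ ξ * (𝓕 b : L2) ξ := by
    rw [Lp.fourier_toTemperedDistribution_eq, Lp.toTemperedDistribution_apply]
    rfl
  constructor
  · intro h
    apply ae_eq_of_integral_contDiff_smul_eq (L2.locallyIntegrable _)
    · exact (L2.locallyIntegrable (𝓕 a)).continuous_smul
        (by fun_prop : Continuous fun ξ : ℝ => (2 * π * Complex.I * ξ : ℂ))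
    · intro g g_smooth g_cpt
      have hg₁ : HasCompactSupport (Complex.ofRealCLM ∘ g) := g_cpt.comp_left rfl
      have hg₂ : ContDiff ℝ _ (Complex.ofRealCLM ∘ g) := Complex.ofRealCLM.contDiff.comp g_smooth
      have := (key2 (hg₁.toSchwartzMap hg₂)).symm.trans ((congrArg (fun T : 𝓢'(ℝ, ℂ) => 𝓕 T _) h.symm).trans
        (key (hg₁.toSchwartzMap hg₂)))
      simpa using this
  · intro h
    have : 𝓕 (TemperedDistribution.derivCLM ℂ (a : 𝓢'(ℝ, ℂ))) = 𝓕 (b : 𝓢'(ℝ, ℂ)) := by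
      ext φ
      rw [key, key2]
      apply integral_congr_ae
      filter_upwards [h] with ξ hξ
      rw [hξ]
    have h2 := congrArg (fun T : 𝓢'(ℝ, ℂ) => 𝓕⁻ T) this
    simpa using h2

theorem fourier_dx (f : H1) :
    ∀ᵐ ξ : ℝ, (𝓕 (dx f) : L2) ξ = 2 * π * Complex.I * ξ * (𝓕 (toL2 f) : L2) ξ :=
  (deriv_eq_iff_fourier _ _).1 f.deriv_eq

/-- An f orthogonal in H¹ to all Schwartz functions satisfies f'' = f as a distribution. On the
Fourier side this is (1 + 4π²ξ²) 𝓕f = 0, so f = 0. Density reduces the product and conjugation rules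
for weak derivatives to Schwartz functions. -/
theorem denseRange_ofSchwartz : DenseRange H1.ofSchwartz := by
  let V : Submodule ℂ H1 :=
    { carrier := Set.range H1.ofSchwartz
      zero_mem' := ⟨0, H1.ext' (map_zero (SchwartzMap.toLpCLM ℂ ℂ 2 volume))
        ((congrArg _ (map_zero _)).trans (map_zero (SchwartzMap.toLpCLM ℂ ℂ 2 volume)))⟩
      add_mem' := by
        rintro _ _ ⟨φ, rfl⟩ ⟨ψ, rfl⟩
        refine ⟨φ + ψ, H1.ext' (map_add (SchwartzMap.toLpCLM ℂ ℂ 2 volume) φ ψ) ?_⟩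
        rw [dx_ofSchwartz, map_add, map_add]
        exact map_add (SchwartzMap.toLpCLM ℂ ℂ 2 volume) _ _
      smul_mem' := by
        rintro c _ ⟨φ, rfl⟩
        refine ⟨c • φ, H1.ext' (map_smul (SchwartzMap.toLpCLM ℂ ℂ 2 volume) c φ) ?_⟩
        rw [dx_ofSchwartz, map_smul, map_smul]
        exact map_smul (SchwartzMap.toLpCLM ℂ ℂ 2 volume) c _ }
  have hV : Vᗮ = ⊥ := by
    rw [eq_bot_iff]
    intro f hf
    have h0 (φ : 𝓢(ℝ, ℂ)) : inner ℂ (H1.ofSchwartz φ) f = 0 :=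
      Submodule.inner_right_of_mem_orthogonal (K := V) ⟨φ, rfl⟩ hf
    have hd : TemperedDistribution.derivCLM ℂ (dx f : 𝓢'(ℝ, ℂ)) = (toL2 f : 𝓢'(ℝ, ℂ)) := by
      ext φ
      -- The inner product conjugates its first argument while distributions act bilinearly, so
      -- orthogonality is tested against the conjugate of φ.
      let c : 𝓢(ℝ, ℂ) →L[ℝ] 𝓢(ℝ, ℂ) := SchwartzMap.postcompCLM (Complex.conjCLE : ℂ →L[ℝ] ℂ)
      have := h0 (c φ)
      rw [H1.inner_eq, toL2_ofSchwartz, dx_ofSchwartz, L2.inner_def, L2.inner_def] at this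
      rw [TemperedDistribution.derivCLM_apply_apply, Lp.toTemperedDistribution_apply,
        Lp.toTemperedDistribution_apply]
      have d1 : ∫ x, inner ℂ ((c φ).toLp 2 volume x) (toL2 f x) = ∫ x, φ x • toL2 f x := by
        apply integral_congr_ae
        filter_upwards [(c φ).coeFn_toLp 2 volume] with x hx
        rw [hx]
        simp [c, mul_comm]
      have d2 : ∫ x, inner ℂ ((SchwartzMap.derivCLM ℂ ℂ (c φ)).toLp 2 volume x) (dx f x)
          = ∫ x, SchwartzMap.derivCLM ℂ ℂ φ x • dx f x := by
        apply integral_congr_ae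
        filter_upwards [(SchwartzMap.derivCLM ℂ ℂ (c φ)).coeFn_toLp 2 volume] with x hx
        have : deriv (c φ) x = star (deriv φ x) := by
          have := (φ.hasDerivAt x).star
          exact this.deriv
        rw [hx, SchwartzMap.derivCLM_apply, SchwartzMap.derivCLM_apply, this]
        simp [mul_comm]
      rw [d1, d2] at this
      rw [eq_neg_of_add_eq_zero_left this, ← integral_neg]
      simp
    have e1 := (deriv_eq_iff_fourier _ _).1 hd
    have e2 := fourier_dx f
    have : 𝓕 (toL2 f) = 0 := by
      apply Lp.ext
      filter_upwards [e1, e2, Lp.coeFn_zero ℂ 2 (volume : Measure ℝ)] with ξ h1 h2 h3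
      rw [h2] at h1
      rw [h3]
      have : (1 + (4 * π ^ 2 * ξ ^ 2 : ℝ) : ℂ) * (𝓕 (toL2 f) : L2) ξ = 0 := by
        push_cast
        linear_combination h1 + 4 * π ^ 2 * ξ ^ 2 * (𝓕 (toL2 f) : L2) ξ * Complex.I_sq
      rcases mul_eq_zero.1 this with h | h
      · exfalso
        have h' : (1 + 4 * π ^ 2 * ξ ^ 2 : ℝ) = 0 := by exact_mod_cast h
        nlinarith [sq_nonneg (π * ξ)]
      · simpa using h
    have : toL2 f = 0 := by
      rw [← norm_eq_zero, ← Lp.norm_fourier_eq, this, norm_zero]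
    exact toL2_injective (this.trans (map_zero _).symm)
  have := (Submodule.topologicalClosure_eq_top_iff (K := V)).2 hV
  intro x
  have hx : x ∈ V.topologicalClosure := by rw [this]; trivial
  exact hx

end PTNLS
end

/-! ### The sup bound, multiplication and conjugation on H¹. -/

noncomputable section

namespace PTNLS

open Filter Topology

theorem L2.integrable_norm_mul (a b : L2) : Integrable fun x => ‖a x‖ * ‖b x‖ :=
  (Lp.memLp a).norm.integrable_mul (Lp.memLp b).norm

theorem L2.integral_norm_mul_le (a b : L2) : ∫ x, ‖a x‖ * ‖b x‖ ≤ ‖a‖ * ‖b‖ := by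
  let a' : Lp ℝ 2 (volume : Measure ℝ) := (Lp.memLp a).norm.toLp
  let b' : Lp ℝ 2 (volume : Measure ℝ) := (Lp.memLp b).norm.toLp
  have ha : ‖a'‖ = ‖a‖ := by
    rw [Lp.norm_toLp, eLpNorm_norm, Lp.norm_def]
  have hb : ‖b'‖ = ‖b‖ := by
    rw [Lp.norm_toLp, eLpNorm_norm, Lp.norm_def]
  have h := real_inner_le_norm a' b'
  rw [L2.inner_def, ha, hb] at h
  refine le_of_eq_of_le (integral_congr_ae ?_) h
  filter_upwards [(Lp.memLp a).norm.coeFn_toLp, (Lp.memLp b).norm.coeFn_toLp] with x h1 h2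
  simp only [a', b', h1, h2]
  simp [mul_comm]

/-- Integrate the derivative of |φ|², which is at most 2 |φ| |φ'|, over (-∞, x] and apply
Cauchy–Schwarz. -/
theorem SchwartzMap.norm_sq_le (φ : 𝓢(ℝ, ℂ)) (x : ℝ) :
    ‖φ x‖ ^ 2 ≤ 2 * ‖toL2 (H1.ofSchwartz φ)‖ * ‖dx (H1.ofSchwartz φ)‖ := by
  have hd (y : ℝ) : HasDerivAt (fun y => ‖φ y‖ ^ 2) (2 * inner ℝ (φ y) (deriv φ y)) y :=
    (φ.hasDerivAt y).norm_sq
  have hae : (fun y => ‖toL2 (H1.ofSchwartz φ) y‖ * ‖dx (H1.ofSchwartz φ) y‖)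
      =ᵐ[volume] fun y => ‖φ y‖ * ‖deriv φ y‖ := by
    filter_upwards [φ.coeFn_toLp 2 volume, (SchwartzMap.derivCLM ℂ ℂ φ).coeFn_toLp 2 volume]
      with y h1 h2
    rw [toL2_ofSchwartz, dx_ofSchwartz, h1, h2, SchwartzMap.derivCLM_apply]
  have hint : Integrable fun y => 2 * (‖φ y‖ * ‖deriv φ y‖) :=
    ((L2.integrable_norm_mul _ _).congr hae).const_mul 2
  have hb (y : ℝ) : ‖2 * inner ℝ (φ y) (deriv φ y)‖ ≤ 2 * (‖φ y‖ * ‖deriv φ y‖) := by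
    rw [norm_mul, Real.norm_ofNat]
    gcongr
    exact norm_inner_le_norm _ _
  have hcont : Continuous fun y => 2 * inner ℝ (φ y) (deriv φ y) := by
    have : Continuous (deriv φ) := (SchwartzMap.derivCLM ℂ ℂ φ).continuous
    fun_prop
  have hint' : Integrable fun y => 2 * inner ℝ (φ y) (deriv φ y) :=
    hint.mono' hcont.aestronglyMeasurable (Eventually.of_forall hb)
  have hlim : Tendsto (fun y => ‖φ y‖ ^ 2) atBot (𝓝 0) := by
    have := (φ.toZeroAtInfty.zero_at_infty').mono_left (atBot_le_cocompact (α := ℝ))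
    simpa using this.norm.pow 2
  have := integral_Iic_of_hasDerivAt_of_tendsto (a := x) (hd x).continuousAt.continuousWithinAt
    (fun y _ => hd y) hint'.integrableOn hlim
  rw [sub_zero] at this
  rw [← this]
  calc ∫ y in Set.Iic x, 2 * inner ℝ (φ y) (deriv φ y)
      ≤ ∫ y in Set.Iic x, 2 * (‖φ y‖ * ‖deriv φ y‖) :=
        integral_mono hint'.integrableOn hint.integrableOn fun y => (le_abs_self _).trans (hb y)
    _ ≤ ∫ y, 2 * (‖φ y‖ * ‖deriv φ y‖) :=
        setIntegral_le_integral hint (Eventually.of_forall fun y => by positivity)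
    _ = 2 * ∫ y, ‖toL2 (H1.ofSchwartz φ) y‖ * ‖dx (H1.ofSchwartz φ) y‖ := by
        rw [integral_const_mul, integral_congr_ae hae]
    _ ≤ _ := by rw [mul_assoc]; gcongr; exact L2.integral_norm_mul_le _ _

/-- L² convergence gives almost everywhere convergence along a subsequence, which is what carries
pointwise bounds from Schwartz functions to H¹. -/
theorem H1.exists_schwartz_seq (f : H1) : ∃ φ : ℕ → 𝓢(ℝ, ℂ),
    Tendsto (fun n => H1.ofSchwartz (φ n)) atTop (𝓝 f) ∧
    ∀ᵐ x, Tendsto (fun n => φ n x) atTop (𝓝 (toL2 f x)) := by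
  obtain ⟨u, hu, hlim⟩ := mem_closure_iff_seq_limit.1 (denseRange_ofSchwartz f)
  choose φ hφ using hu
  obtain rfl : (fun n => H1.ofSchwartz (φ n)) = u := funext hφ
  have h2 : Tendsto (fun n => toL2 (H1.ofSchwartz (φ n))) atTop (𝓝 (toL2 f)) :=
    (toL2.continuous.tendsto f).comp hlim
  obtain ⟨ns, hns, hae⟩ := (tendstoInMeasure_of_tendsto_Lp h2).exists_seq_tendsto_ae
  refine ⟨fun n => φ (ns n), hlim.comp hns.tendsto_atTop, ?_⟩
  have : ∀ᵐ x, ∀ n, toL2 (H1.ofSchwartz (φ (ns n))) x = φ (ns n) x :=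
    ae_all_iff.2 fun n => (φ (ns n)).coeFn_toLp 2 volume
  filter_upwards [hae, this] with x h1 h2
  simpa only [h2] using h1

/-- The Gagliardo–Nirenberg inequality for the supremum. -/
theorem H1.ae_norm_sq_le (f : H1) : ∀ᵐ x, ‖toL2 f x‖ ^ 2 ≤ 2 * ‖toL2 f‖ * ‖dx f‖ := by
  obtain ⟨φ, hφ, hae⟩ := f.exists_schwartz_seq
  filter_upwards [hae] with x hx
  refine le_of_tendsto_of_tendsto' (hx.norm.pow 2) ?_ fun n => SchwartzMap.norm_sq_le (φ n) x
  exact (((toL2.continuous.tendsto f).comp hφ).norm.const_mul 2).mul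
    (((dx.continuous.tendsto f).comp hφ).norm)

theorem H1.ae_norm_le (f : H1) : ∀ᵐ x, ‖toL2 f x‖ ≤ √(2 * ‖toL2 f‖ * ‖dx f‖) := by
  filter_upwards [f.ae_norm_sq_le] with x hx
  exact Real.le_sqrt_of_sq_le hx

theorem H1.memLp_top (f : H1) : MemLp (toL2 f) ∞ volume :=
  memLp_top_of_bound (Lp.aestronglyMeasurable _) _ f.ae_norm_le

theorem H1.norm_toLp_top_le (f : H1) : ‖f.memLp_top.toLp‖ ≤ √(2 * ‖toL2 f‖ * ‖dx f‖) := by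
  rw [Lp.norm_toLp]
  refine ENNReal.toReal_le_of_le_ofReal (Real.sqrt_nonneg _) ?_
  rw [eLpNorm_exponent_top]
  exact eLpNormEssSup_le_of_ae_bound f.ae_norm_le

/-- The embedding of `H¹` into `L^∞`. -/
def toLinf : H1 →L[ℂ] Lp ℂ ∞ (volume : Measure ℝ) :=
  LinearMap.mkContinuous
    { toFun := fun f => f.memLp_top.toLp
      map_add' := fun f g => by
        rw [← MemLp.toLp_add]
        exact MemLp.toLp_congr _ _ (by rw [map_add]; exact Lp.coeFn_add _ _)
      map_smul' := fun c f => by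
        rw [RingHom.id_apply, ← MemLp.toLp_const_smul]
        exact MemLp.toLp_congr _ _ (by rw [map_smul]; exact Lp.coeFn_smul _ _) }
    1 fun f => by
      refine f.norm_toLp_top_le.trans ?_
      rw [one_mul]
      apply Real.sqrt_le_iff.2 ⟨norm_nonneg _, ?_⟩
      rw [H1.norm_sq_eq]
      nlinarith [sq_nonneg (‖toL2 f‖ - ‖dx f‖)]

theorem coeFn_toLinf (f : H1) : toLinf f =ᵐ[volume] toL2 f := f.memLp_top.coeFn_toLp

theorem norm_toLinf_sq_le (f : H1) : ‖toLinf f‖ ^ 2 ≤ 2 * ‖toL2 f‖ * ‖dx f‖ := by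
  have := pow_le_pow_left₀ (norm_nonneg _) f.norm_toLp_top_le 2
  rwa [Real.sq_sqrt (by positivity)] at this

theorem norm_toLinf_le (f : H1) : ‖toLinf f‖ ≤ ‖f‖ := by
  simpa using toLinf.le_of_opNorm_le (LinearMap.mkContinuous_norm_le _ zero_le_one _) f

/-- Multiplication `L^∞ × L² → L²`. -/
def mulLinf : Lp ℂ ∞ (volume : Measure ℝ) →L[ℂ] L2 →L[ℂ] L2 :=
  (ContinuousLinearMap.mul ℂ ℂ).holderL volume ∞ 2 2

theorem coeFn_mulLinf (m : Lp ℂ ∞ (volume : Measure ℝ)) (a : L2) :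
    mulLinf m a =ᵐ[volume] fun x => m x * a x :=
  (ContinuousLinearMap.mul ℂ ℂ).coeFn_holder (r := 2) m a

theorem norm_mulLinf_le (m : Lp ℂ ∞ (volume : Measure ℝ)) (a : L2) :
    ‖mulLinf m a‖ ≤ ‖m‖ * ‖a‖ := by
  have := (ContinuousLinearMap.mul ℂ ℂ).norm_holder_apply_apply_le (r := 2) m a
  rwa [ContinuousLinearMap.opNorm_mul, one_mul] at this

/-- Both sides are continuous in (f, g) for the H¹ norms, thanks to the embedding into L^∞, so the
Leibniz rule extends from Schwartz functions by density. -/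
theorem deriv_mul_eq (f g : H1) :
    TemperedDistribution.derivCLM ℂ ((mulLinf (toLinf f) (toL2 g) : L2) : 𝓢'(ℝ, ℂ))
      = ((mulLinf (toLinf f) (dx g) + mulLinf (toLinf g) (dx f) : L2) : 𝓢'(ℝ, ℂ)) := by
  refine denseRange_ofSchwartz.induction_on₂ (p := fun f g : H1 =>
    TemperedDistribution.derivCLM ℂ ((mulLinf (toLinf f) (toL2 g) : L2) : 𝓢'(ℝ, ℂ))
      = ((mulLinf (toLinf f) (dx g) + mulLinf (toLinf g) (dx f) : L2) : 𝓢'(ℝ, ℂ))) ?_ ?_ f g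
  · exact isClosed_deriv_eq (X := H1 × H1) (by fun_prop) (by fun_prop)
  · intro φ ψ
    have h := (H1.ofSchwartz (SchwartzMap.pairing (ContinuousLinearMap.mul ℂ ℂ) φ ψ)).deriv_eq
    have a1 := (coeFn_toLinf (H1.ofSchwartz φ)).trans (φ.coeFn_toLp 2 volume)
    have a2 := (coeFn_toLinf (H1.ofSchwartz ψ)).trans (ψ.coeFn_toLp 2 volume)
    have a3 := ψ.coeFn_toLp 2 volume
    have a4 := (SchwartzMap.derivCLM ℂ ℂ φ).coeFn_toLp 2 volume
    have a5 := (SchwartzMap.derivCLM ℂ ℂ ψ).coeFn_toLp 2 volume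
    convert h using 2
    · congr 1
      apply Lp.ext
      filter_upwards [coeFn_mulLinf (toLinf (H1.ofSchwartz φ)) (toL2 (H1.ofSchwartz ψ)), a1, a3,
        (SchwartzMap.pairing (ContinuousLinearMap.mul ℂ ℂ) φ ψ).coeFn_toLp 2 volume]
        with x h1 h2 h3 h4
      rw [h1, h2, toL2_ofSchwartz, h3, toL2_ofSchwartz, h4]
      simp
    · apply Lp.ext
      filter_upwards [coeFn_mulLinf (toLinf (H1.ofSchwartz φ)) (dx (H1.ofSchwartz ψ)), a1, a2, a4,
        a5, coeFn_mulLinf (toLinf (H1.ofSchwartz ψ)) (dx (H1.ofSchwartz φ)), Lp.coeFn_add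
          (mulLinf (toLinf (H1.ofSchwartz φ)) (dx (H1.ofSchwartz ψ)))
          (mulLinf (toLinf (H1.ofSchwartz ψ)) (dx (H1.ofSchwartz φ))),
        (SchwartzMap.derivCLM ℂ ℂ
          (SchwartzMap.pairing (ContinuousLinearMap.mul ℂ ℂ) φ ψ)).coeFn_toLp 2 volume]
        with x h1 h2 h3 h4 h5 h6 h7 h8
      rw [h7, Pi.add_apply, h1, h6, h2, h3]
      rw [dx_ofSchwartz, dx_ofSchwartz, dx_ofSchwartz, h4, h5, h8]
      rw [SchwartzMap.derivCLM_apply, SchwartzMap.derivCLM_apply, SchwartzMap.derivCLM_apply]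
      have : (SchwartzMap.pairing (ContinuousLinearMap.mul ℂ ℂ) φ ψ : ℝ → ℂ)
          = fun x => φ x * ψ x := by
        ext y; simp
      rw [this, ((φ.hasDerivAt x).fun_mul (ψ.hasDerivAt x)).deriv]
      ring

/-- Multiplication in `H¹`. -/
def mul : H1 →L[ℂ] H1 →L[ℂ] H1 :=
  LinearMap.mkContinuous₂
    (LinearMap.mk₂ ℂ (fun f g => H1.mk _ _ (deriv_mul_eq f g))
      (fun f f' g => H1.ext' (by simp) (by simp; abel))
      (fun c f g => by apply H1.ext' <;> simp)
      (fun f g g' => H1.ext' (by simp) (by simp; abel))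
      (fun c f g => by apply H1.ext' <;> simp))
    3 fun f g => by
      refine (H1.norm_le_add _).trans ?_
      simp only [LinearMap.mk₂_apply, toL2_mk, dx_mk]
      have h1 := norm_mulLinf_le (toLinf f) (toL2 g)
      have h2 := norm_mulLinf_le (toLinf f) (dx g)
      have h3 := norm_mulLinf_le (toLinf g) (dx f)
      have h4 := norm_add_le (mulLinf (toLinf f) (dx g)) (mulLinf (toLinf g) (dx f))
      have i1 : ‖toLinf f‖ * ‖toL2 g‖ ≤ ‖f‖ * ‖g‖ :=
        mul_le_mul (norm_toLinf_le f) (norm_toL2_le g) (norm_nonneg _) (norm_nonneg _)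
      have i2 : ‖toLinf f‖ * ‖dx g‖ ≤ ‖f‖ * ‖g‖ :=
        mul_le_mul (norm_toLinf_le f) (norm_dx_le g) (norm_nonneg _) (norm_nonneg _)
      have i3 : ‖toLinf g‖ * ‖dx f‖ ≤ ‖g‖ * ‖f‖ :=
        mul_le_mul (norm_toLinf_le g) (norm_dx_le f) (norm_nonneg _) (norm_nonneg _)
      linarith

theorem norm_mul_le' (f g : H1) : ‖mul f g‖ ≤ 3 * ‖f‖ * ‖g‖ :=
  mul.le_of_opNorm₂_le_of_le (LinearMap.mkContinuous₂_norm_le _ (by norm_num) _) le_rfl le_rfl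

theorem toL2_mul (f g : H1) : toL2 (mul f g) = mulLinf (toLinf f) (toL2 g) := rfl

theorem coeFn_toL2_mul (f g : H1) : toL2 (mul f g) =ᵐ[volume] fun x => toL2 f x * toL2 g x := by
  filter_upwards [coeFn_mulLinf (toLinf f) (toL2 g), coeFn_toLinf f] with x h1 h2
  rw [toL2_mul, h1, h2]

theorem norm_toL2_mul_le (f g : H1) : ‖toL2 (mul f g)‖ ≤ ‖toLinf f‖ * ‖toL2 g‖ :=
  norm_mulLinf_le _ _

theorem mul_comm' (f g : H1) : mul f g = mul g f := by
  apply H1.ext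
  filter_upwards [coeFn_toL2_mul f g, coeFn_toL2_mul g f] with x h1 h2
  rw [h1, h2, mul_comm]

/-- Complex conjugation on `L²`. -/
def conjL2 : L2 →L[ℝ] L2 := (Complex.conjCLE : ℂ →L[ℝ] ℂ).compLpL 2 volume

theorem coeFn_conjL2 (a : L2) : conjL2 a =ᵐ[volume] fun x => starRingEnd ℂ (a x) :=
  ContinuousLinearMap.coeFn_compLpL _ a

theorem norm_conjL2 (a : L2) : ‖conjL2 a‖ = ‖a‖ := by
  apply le_antisymm <;> apply Lp.norm_le_norm_of_ae_le <;>
  · filter_upwards [coeFn_conjL2 a] with x hx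
    rw [hx, Complex.norm_conj]

theorem deriv_conj_eq (f : H1) :
    TemperedDistribution.derivCLM ℂ (conjL2 (toL2 f) : 𝓢'(ℝ, ℂ))
      = (conjL2 (dx f) : 𝓢'(ℝ, ℂ)) := by
  refine denseRange_ofSchwartz.induction_on (p := fun f : H1 =>
    TemperedDistribution.derivCLM ℂ (conjL2 (toL2 f) : 𝓢'(ℝ, ℂ))
      = (conjL2 (dx f) : 𝓢'(ℝ, ℂ))) f ?_ ?_
  · exact isClosed_deriv_eq (by fun_prop) (by fun_prop)
  · intro φ
    let c : 𝓢(ℝ, ℂ) := SchwartzMap.postcompCLM (Complex.conjCLE : ℂ →L[ℝ] ℂ) φ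
    convert (H1.ofSchwartz c).deriv_eq using 2
    · congr 1
    · apply Lp.ext
      filter_upwards [coeFn_conjL2 (dx (H1.ofSchwartz φ)),
        (SchwartzMap.derivCLM ℂ ℂ φ).coeFn_toLp 2 volume,
        (SchwartzMap.derivCLM ℂ ℂ c).coeFn_toLp 2 volume] with x h1 h2 h3
      have : deriv c x = star (deriv φ x) := (φ.hasDerivAt x).star.deriv
      rw [h1, dx_ofSchwartz, h2, dx_ofSchwartz, h3, SchwartzMap.derivCLM_apply,
        SchwartzMap.derivCLM_apply, this]
      rfl

/-- Complex conjugation on `H¹`. -/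
def conj : H1 →L[ℝ] H1 :=
  LinearMap.mkContinuous
    { toFun := fun f => H1.mk _ _ (deriv_conj_eq f)
      map_add' := fun f g => by apply H1.ext' <;> simp
      map_smul' := fun c f => by
        apply H1.ext' <;> simp }
    1 fun f => by
      rw [one_mul]
      apply le_of_sq_le_sq _ (norm_nonneg _)
      rw [H1.norm_sq_eq, H1.norm_sq_eq]
      simp [norm_conjL2]

@[simp] theorem toL2_conj (f : H1) : toL2 (conj f) = conjL2 (toL2 f) := rfl

@[simp] theorem dx_conj (f : H1) : dx (conj f) = conjL2 (dx f) := rfl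

theorem norm_conj' (f : H1) : ‖conj f‖ = ‖f‖ := by
  rw [← sq_eq_sq₀ (norm_nonneg _) (norm_nonneg _), H1.norm_sq_eq, H1.norm_sq_eq, toL2_conj, dx_conj,
    norm_conjL2, norm_conjL2]

theorem coeFn_toL2_conj (f : H1) : toL2 (conj f) =ᵐ[volume] fun x => starRingEnd ℂ (toL2 f x) :=
  coeFn_conjL2 _

@[simp] theorem conj_conj' (f : H1) : conj (conj f) = f := by
  apply H1.ext
  filter_upwards [coeFn_toL2_conj f, coeFn_toL2_conj (conj f)] with x h1 h2
  rw [h2, h1, Complex.conj_conj]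

theorem conj_mul (f g : H1) : conj (mul f g) = mul (conj f) (conj g) := by
  apply H1.ext
  filter_upwards [coeFn_toL2_conj f, coeFn_toL2_conj g, coeFn_toL2_conj (mul f g),
    coeFn_toL2_mul f g, coeFn_toL2_mul (conj f) (conj g)] with x h1 h2 h3 h4 h5
  rw [h3, h4, h5, h1, h2, map_mul]

theorem conj_smul (c : ℂ) (f : H1) : conj (c • f) = starRingEnd ℂ c • conj f := by
  apply H1.ext
  rw [toL2.map_smul, toL2_conj, toL2.map_smul, toL2_conj]
  filter_upwards [coeFn_toL2_conj f, coeFn_conjL2 (c • toL2 f), Lp.coeFn_smul c (toL2 f),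
    Lp.coeFn_smul (starRingEnd ℂ c) (conjL2 (toL2 f))] with x h1 h2 h3 h4
  rw [h2, h3, h4, Pi.smul_apply, Pi.smul_apply, ← toL2_conj, h1, smul_eq_mul, smul_eq_mul, map_mul]

end PTNLS
end

/-! ### Bilinear pairings and the Dirichlet form. -/

noncomputable section

namespace PTNLS

open Filter Topology FourierTransform

/-- The bilinear pairing of `L²`. -/
def pairL2 : L2 →L[ℂ] L2 →L[ℂ] ℂ := (ContinuousLinearMap.mul ℂ ℂ).lpPairing volume 2 2

theorem pairL2_apply (a b : L2) : pairL2 a b = ∫ x, a x * b x := by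
  simp [pairL2, ContinuousLinearMap.lpPairing_eq_integral]

theorem pairL2_comm (a b : L2) : pairL2 a b = pairL2 b a := by
  simp [pairL2_apply, mul_comm]

theorem pairL2_conj_left (a b : L2) : pairL2 (conjL2 a) b = inner ℂ a b := by
  rw [pairL2_apply, L2.inner_def]
  apply integral_congr_ae
  filter_upwards [coeFn_conjL2 a] with x hx
  rw [hx]
  simp [mul_comm]

theorem conjL2_conjL2 (a : L2) : conjL2 (conjL2 a) = a := by
  apply Lp.ext
  filter_upwards [coeFn_conjL2 a, coeFn_conjL2 (conjL2 a)] with x h1 h2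
  rw [h2, h1, Complex.conj_conj]

theorem pairL2_eq_inner (a b : L2) : pairL2 a b = inner ℂ (conjL2 a) b := by
  rw [← pairL2_conj_left, conjL2_conjL2]

theorem norm_pairL2_le (a b : L2) : ‖pairL2 a b‖ ≤ ‖a‖ * ‖b‖ := by
  rw [pairL2_eq_inner, ← norm_conjL2 a]
  exact norm_inner_le_norm _ _

theorem conj_pairL2 (a b : L2) :
    starRingEnd ℂ (pairL2 a b) = pairL2 (conjL2 a) (conjL2 b) := by
  rw [pairL2_apply, pairL2_apply, ← integral_conj]
  apply integral_congr_ae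
  filter_upwards [coeFn_conjL2 a, coeFn_conjL2 b] with x h1 h2
  rw [h1, h2, map_mul]

/-- The embedding of `H¹` into `H⁻¹` as a continuous linear map. -/
def ι : H1 →L[ℂ] HNeg1 := pairL2.bilinearComp toL2 toL2

/-- The Dirichlet form `∫ f' g'`. -/
def dform : H1 →L[ℂ] HNeg1 := pairL2.bilinearComp dx dx

theorem ι_apply (f g : H1) : ι f g = pairL2 (toL2 f) (toL2 g) := rfl

theorem dform_apply (f g : H1) : dform f g = pairL2 (dx f) (dx g) := rfl

theorem ι_comm (f g : H1) : ι f g = ι g f := pairL2_comm _ _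

theorem dform_comm (f g : H1) : dform f g = dform g f := pairL2_comm _ _

theorem conj_ι (f g : H1) : starRingEnd ℂ (ι f g) = ι (conj f) (conj g) := conj_pairL2 _ _

theorem conj_dform (f g : H1) : starRingEnd ℂ (dform f g) = dform (conj f) (conj g) :=
  conj_pairL2 _ _

theorem ι_conj (f g : H1) : ι (conj f) g = inner ℂ (toL2 f) (toL2 g) := pairL2_conj_left _ _

theorem dform_conj (f g : H1) : dform (conj f) g = inner ℂ (dx f) (dx g) := pairL2_conj_left _ _

theorem norm_ι_le (f g : H1) : ‖ι f g‖ ≤ ‖toL2 f‖ * ‖toL2 g‖ := norm_pairL2_le _ _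

/-- Shifting a factor across the pairing expresses the product f g in H⁻¹ as ι f composed with
multiplication by g. This is what makes a product rule in H⁻¹ possible. -/
theorem ι_mul (f g h : H1) : ι (mul f g) h = ι f (mul g h) := by
  rw [ι_apply, ι_apply, pairL2_apply, pairL2_apply]
  apply integral_congr_ae
  filter_upwards [coeFn_toL2_mul f g, coeFn_toL2_mul g h] with x h1 h2
  rw [h1, h2, mul_assoc]

/-- The operator `i ∂ₓ²` from `H¹` to `H⁻¹`. -/
def schrodingerOp : H1 →L[ℂ] HNeg1 := (-Complex.I) • dform

theorem schrodingerOp_apply (f g : H1) : schrodingerOp f g = -Complex.I * dform f g := rfl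

/-! ### The free Schrödinger group. -/

/-- The symbol of the free Schrödinger group. -/
def symbol (t ξ : ℝ) : ℂ := Complex.exp (((-(4 * Real.pi ^ 2 * t * ξ ^ 2) : ℝ) : ℂ) * Complex.I)

theorem norm_symbol (t ξ : ℝ) : ‖symbol t ξ‖ = 1 := Complex.norm_exp_ofReal_mul_I _

theorem symbol_add (s t ξ : ℝ) : symbol (s + t) ξ = symbol s ξ * symbol t ξ := by
  rw [symbol, symbol, symbol, ← Complex.exp_add]
  congr 1
  push_cast
  ring

theorem symbol_zero (ξ : ℝ) : symbol 0 ξ = 1 := by simp [symbol]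

theorem continuous_symbol (t : ℝ) : Continuous (symbol t) := by
  unfold symbol
  fun_prop

theorem continuous_symbol_left (ξ : ℝ) : Continuous fun t => symbol t ξ := by
  unfold symbol
  fun_prop

theorem hasDerivAt_symbol (t ξ : ℝ) :
    HasDerivAt (fun t => symbol t ξ) (-Complex.I * (4 * Real.pi ^ 2 * ξ ^ 2 : ℝ) * symbol t ξ) t := by
  have h : HasDerivAt (fun t : ℝ => ((-(4 * Real.pi ^ 2 * t * ξ ^ 2) : ℝ) : ℂ) * Complex.I)
      (((-(4 * Real.pi ^ 2 * ξ ^ 2) : ℝ) : ℂ) * Complex.I) t := by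
    apply HasDerivAt.mul_const
    apply HasDerivAt.ofReal_comp
    have := (((hasDerivAt_id t).const_mul (4 * Real.pi ^ 2)).mul_const (ξ ^ 2)).fun_neg
    simpa using this
  refine h.cexp.congr_deriv ?_
  change symbol t ξ * _ = _
  push_cast
  ring

theorem memLp_symbol (t : ℝ) : MemLp (symbol t) ∞ volume :=
  memLp_top_of_bound (continuous_symbol t).aestronglyMeasurable 1
    (Eventually.of_forall fun ξ => (norm_symbol t ξ).le)

/-- The free Schrödinger group on `L²`. -/
def freeL2 (t : ℝ) : L2 →L[ℂ] L2 :=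
  ((Lp.fourierTransformₗᵢ ℝ ℂ).symm.toContinuousLinearEquiv : L2 →L[ℂ] L2) ∘L
    mulLinf (memLp_symbol t).toLp ∘L
    ((Lp.fourierTransformₗᵢ ℝ ℂ).toContinuousLinearEquiv : L2 →L[ℂ] L2)

theorem fourier_freeL2 (t : ℝ) (a : L2) :
    (𝓕 (freeL2 t a) : L2) =ᵐ[volume] fun ξ => symbol t ξ * (𝓕 a : L2) ξ := by
  have h : 𝓕 (freeL2 t a) = mulLinf (memLp_symbol t).toLp (𝓕 a) :=
    (Lp.fourierTransformₗᵢ ℝ ℂ).apply_symm_apply _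
  rw [h]
  filter_upwards [coeFn_mulLinf (memLp_symbol t).toLp (𝓕 a), (memLp_symbol t).coeFn_toLp]
    with ξ h1 h2
  rw [h1, h2]

theorem L2.fourier_injective {a b : L2} (h : (𝓕 a : L2) =ᵐ[volume] (𝓕 b : L2)) : a = b :=
  (Lp.fourierTransformₗᵢ ℝ ℂ).injective (Lp.ext h)

theorem freeL2_add (s t : ℝ) (a : L2) : freeL2 (s + t) a = freeL2 s (freeL2 t a) := by
  apply L2.fourier_injective
  filter_upwards [fourier_freeL2 (s + t) a, fourier_freeL2 s (freeL2 t a), fourier_freeL2 t a]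
    with ξ h1 h2 h3
  rw [h1, h2, h3, symbol_add, mul_assoc]

theorem freeL2_zero (a : L2) : freeL2 0 a = a := by
  apply L2.fourier_injective
  filter_upwards [fourier_freeL2 0 a] with ξ h1
  rw [h1, symbol_zero, one_mul]

theorem norm_freeL2 (t : ℝ) (a : L2) : ‖freeL2 t a‖ = ‖a‖ := by
  rw [← Lp.norm_fourier_eq, ← Lp.norm_fourier_eq a]
  apply le_antisymm <;> apply Lp.norm_le_norm_of_ae_le <;>
  · filter_upwards [fourier_freeL2 t a] with ξ h
    rw [h, norm_mul, norm_symbol, one_mul]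

theorem inner_freeL2 (t : ℝ) (a b : L2) : inner ℂ (freeL2 t a) (freeL2 t b) = inner ℂ a b :=
  (⟨(freeL2 t : L2 →ₗ[ℂ] L2), norm_freeL2 t⟩ : L2 →ₗᵢ[ℂ] L2).inner_map_map a b

theorem inner_freeL2_right (t : ℝ) (a b : L2) :
    inner ℂ b (freeL2 t a) = ∫ ξ, symbol t ξ * inner ℂ ((𝓕 b : L2) ξ) ((𝓕 a : L2) ξ) := by
  rw [← Lp.inner_fourier_eq, L2.inner_def]
  apply integral_congr_ae
  filter_upwards [fourier_freeL2 t a] with ξ h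
  rw [h, ← smul_eq_mul (symbol t ξ), inner_smul_right]

/-- Weak continuity follows by dominated convergence on the Fourier side; together with conservation
of the norm it gives strong continuity. -/
theorem continuous_freeL2 (a : L2) : Continuous fun t => freeL2 t a := by
  have hw (b : L2) : Continuous fun t => inner ℂ b (freeL2 t a) := by
    simp_rw [inner_freeL2_right]
    refine continuous_of_dominated (bound := fun ξ => ‖inner ℂ ((𝓕 b : L2) ξ) ((𝓕 a : L2) ξ)‖)
      (fun t => ?_) (fun t => ?_) ?_ ?_
    · exact (continuous_symbol t).aestronglyMeasurable.mul
        (L2.integrable_inner (𝕜 := ℂ) (𝓕 b : L2) (𝓕 a)).aestronglyMeasurable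
    · filter_upwards with ξ
      rw [norm_mul, norm_symbol, one_mul]
    · exact (L2.integrable_inner (𝕜 := ℂ) (𝓕 b : L2) (𝓕 a)).norm
    · filter_upwards with ξ
      exact (continuous_symbol_left ξ).mul continuous_const
  rw [continuous_iff_continuousAt]
  intro s
  rw [ContinuousAt, tendsto_iff_norm_sub_tendsto_zero]
  have hsq (t : ℝ) : ‖freeL2 t a - freeL2 s a‖ ^ 2
      = 2 * ‖a‖ ^ 2 - 2 * (inner ℂ (freeL2 s a) (freeL2 t a)).re := by
    rw [@norm_sub_sq ℂ, norm_freeL2, norm_freeL2, ← inner_re_symm]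
    simp only [RCLike.re_to_complex]
    ring
  have h0 : Tendsto (fun t => ‖freeL2 t a - freeL2 s a‖ ^ 2) (𝓝 s) (𝓝 0) := by
    simp_rw [hsq]
    have := (Complex.continuous_re.comp (hw (freeL2 s a))).tendsto s
    have h := (this.const_mul 2).const_sub (2 * ‖a‖ ^ 2)
    rwa [Function.comp_apply, inner_freeL2, inner_self_eq_norm_sq_to_K, ← RCLike.ofReal_pow,
      RCLike.ofReal_eq_complex_ofReal, Complex.ofReal_re, sub_self] at h
  have := h0.sqrt
  simpa [Real.sqrt_sq] using this

theorem deriv_freeL2_eq (t : ℝ) (f : H1) :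
    TemperedDistribution.derivCLM ℂ (freeL2 t (toL2 f) : 𝓢'(ℝ, ℂ))
      = (freeL2 t (dx f) : 𝓢'(ℝ, ℂ)) := by
  rw [deriv_eq_iff_fourier]
  filter_upwards [fourier_freeL2 t (toL2 f), fourier_freeL2 t (dx f), fourier_dx f] with ξ h1 h2 h3
  rw [h1, h2, h3]
  ring

/-- The free Schrödinger group on `H¹`. -/
def free (t : ℝ) : H1 →L[ℂ] H1 :=
  LinearMap.mkContinuous
    { toFun := fun f => H1.mk _ _ (deriv_freeL2_eq t f)
      map_add' := fun f g => by apply H1.ext' <;> simp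
      map_smul' := fun c f => by apply H1.ext' <;> simp }
    1 fun f => by
      rw [one_mul]
      apply le_of_sq_le_sq _ (norm_nonneg _)
      rw [H1.norm_sq_eq, H1.norm_sq_eq]
      simp [norm_freeL2]

@[simp] theorem toL2_free (t : ℝ) (f : H1) : toL2 (free t f) = freeL2 t (toL2 f) := rfl

@[simp] theorem dx_free (t : ℝ) (f : H1) : dx (free t f) = freeL2 t (dx f) := rfl

theorem free_add (s t : ℝ) (f : H1) : free (s + t) f = free s (free t f) :=
  toL2_injective (freeL2_add s t _)

theorem free_zero (f : H1) : free 0 f = f := toL2_injective (freeL2_zero _)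

theorem free_free_neg (t : ℝ) (f : H1) : free t (free (-t) f) = f := by
  rw [← free_add, add_neg_cancel, free_zero]

theorem norm_free (t : ℝ) (f : H1) : ‖free t f‖ = ‖f‖ := by
  rw [← sq_eq_sq₀ (norm_nonneg _) (norm_nonneg _), H1.norm_sq_eq, H1.norm_sq_eq, toL2_free, dx_free,
    norm_freeL2, norm_freeL2]

theorem continuous_free (f : H1) : Continuous fun t => free t f := by
  rw [continuous_iff_continuousAt]
  intro s
  rw [ContinuousAt, tendsto_iff_norm_sub_tendsto_zero]
  have h1 := tendsto_iff_norm_sub_tendsto_zero.1 ((continuous_freeL2 (toL2 f)).tendsto s)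
  have h2 := tendsto_iff_norm_sub_tendsto_zero.1 ((continuous_freeL2 (dx f)).tendsto s)
  refine squeeze_zero (fun _ => norm_nonneg _) (fun t => H1.norm_le_add _) ?_
  simpa using h1.add h2

/-- The group is jointly continuous. -/
theorem tendsto_free {X : Type*} {l : Filter X} {τ : X → ℝ} {z : X → H1} {t : ℝ} {f : H1}
    (hτ : Tendsto τ l (𝓝 t)) (hz : Tendsto z l (𝓝 f)) :
    Tendsto (fun x => free (τ x) (z x)) l (𝓝 (free t f)) := by
  have h1 := ((continuous_free f).tendsto t).comp hτ
  have h2 : Tendsto (fun x => free (τ x) (z x - f)) l (𝓝 0) := by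
    rw [tendsto_zero_iff_norm_tendsto_zero]
    simp_rw [norm_free]
    exact tendsto_iff_norm_sub_tendsto_zero.1 hz
  have := h1.add h2
  simpa using this

/-- A family of functionals that is pointwise differentiable with norm continuous derivative is
differentiable in norm. -/
theorem hasDerivAt_of_forall_apply {X : Type*} [NormedAddCommGroup X] [NormedSpace ℂ X]
    {g g' : ℝ → StrongDual ℂ X} (hg' : Continuous g')
    (h : ∀ φ t, HasDerivAt (fun s => g s φ) (g' t φ) t) (t : ℝ) : HasDerivAt g (g' t) t := by
  have hg : g = fun t => g 0 + ∫ s in (0 : ℝ)..t, g' s := by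
    ext s φ
    have hc : Continuous fun s => g' s φ := by fun_prop
    have := intervalIntegral.integral_eq_sub_of_hasDerivAt (fun x _ => h φ x)
      (hc.intervalIntegrable 0 s)
    rw [add_apply, ContinuousLinearMap.intervalIntegral_apply
      (hg'.intervalIntegrable _ _), this]
    ring
  rw [hg]
  exact (intervalIntegral.integral_hasDerivAt_right (hg'.intervalIntegrable _ _)
    (hg'.stronglyMeasurableAtFilter _ _) hg'.continuousAt).const_add _

/-- Differentiate under the Fourier integral. The factor 4π²ξ² is shared between φ and f, so |𝓕φ'|
|𝓕f'| is an integrable bound uniform in time; one derivative on each side suffices. -/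
theorem hasDerivAt_inner_freeL2 (f φ : H1) (t : ℝ) :
    HasDerivAt (fun s => inner ℂ (toL2 φ) (freeL2 s (toL2 f)))
      (-Complex.I * inner ℂ (dx φ) (freeL2 t (dx f))) t := by
  have e (s : ℝ) : -Complex.I * inner ℂ (dx φ) (freeL2 s (dx f))
      = ∫ ξ, -Complex.I * (4 * Real.pi ^ 2 * ξ ^ 2 : ℝ) * symbol s ξ
        * inner ℂ ((𝓕 (toL2 φ) : L2) ξ) ((𝓕 (toL2 f) : L2) ξ) := by
    rw [inner_freeL2_right, ← integral_const_mul]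
    apply integral_congr_ae
    filter_upwards [fourier_dx f, fourier_dx φ] with ξ h1 h2
    rw [h1, h2]
    simp only [RCLike.inner_apply, map_mul, Complex.conj_ofReal, Complex.conj_I, map_ofNat]
    push_cast
    linear_combination (4 * Complex.I * symbol s ξ * Real.pi ^ 2 * ξ ^ 2
      * (𝓕 (toL2 f) : L2) ξ * starRingEnd ℂ ((𝓕 (toL2 φ) : L2) ξ)) * Complex.I_sq
  have hmeas := (L2.integrable_inner (𝕜 := ℂ) (𝓕 (toL2 φ) : L2) (𝓕 (toL2 f))).aestronglyMeasurable
  have key := (hasDerivAt_integral_of_dominated_loc_of_deriv_le (μ := volume) (x₀ := t)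
    (F := fun s ξ => symbol s ξ * inner ℂ ((𝓕 (toL2 φ) : L2) ξ) ((𝓕 (toL2 f) : L2) ξ))
    (F' := fun s ξ => -Complex.I * (4 * Real.pi ^ 2 * ξ ^ 2 : ℝ) * symbol s ξ
        * inner ℂ ((𝓕 (toL2 φ) : L2) ξ) ((𝓕 (toL2 f) : L2) ξ))
    (bound := fun ξ => ‖(𝓕 (dx φ) : L2) ξ‖ * ‖(𝓕 (dx f) : L2) ξ‖)
    (s := Set.univ) Filter.univ_mem ?_ ?_ ?_ ?_ (L2.integrable_norm_mul _ _) ?_).2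
  · rw [e]
    simp_rw [inner_freeL2_right]
    exact key
  · filter_upwards with s
    exact (continuous_symbol s).aestronglyMeasurable.mul hmeas
  · refine (L2.integrable_inner (𝕜 := ℂ) (𝓕 (toL2 φ) : L2) (𝓕 (toL2 f))).mono
      ((continuous_symbol t).aestronglyMeasurable.mul hmeas) ?_
    filter_upwards with ξ
    rw [norm_mul, norm_symbol, one_mul]
  · refine AEStronglyMeasurable.mul ?_ hmeas
    refine Continuous.aestronglyMeasurable ?_
    have := continuous_symbol t
    fun_prop
  · filter_upwards [fourier_dx f, fourier_dx φ] with ξ h1 h2 s _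
    rw [h1, h2]
    simp only [RCLike.inner_apply, norm_mul, norm_symbol, norm_neg, Complex.norm_I, RCLike.norm_conj,
      Complex.norm_real, Real.norm_eq_abs, Complex.norm_ofNat, abs_pow, sq_abs]
    rw [abs_of_nonneg (show (0:ℝ) ≤ Real.pi by positivity), abs_of_nonneg (show (0:ℝ) ≤ 4 by norm_num),
      ← sq_abs ξ]
    apply le_of_eq
    ring
  · filter_upwards with ξ s _
    exact (hasDerivAt_symbol s ξ).mul_const _

theorem hasDerivAt_ι_free (f : H1) (t : ℝ) :
    HasDerivAt (fun s => ι (free s f)) (schrodingerOp (free t f)) t := by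
  refine hasDerivAt_of_forall_apply (g' := fun t => schrodingerOp (free t f)) ?_ ?_ t
  · exact schrodingerOp.continuous.comp (continuous_free f)
  · intro φ t
    have := hasDerivAt_inner_freeL2 f (conj φ) t
    have e1 (s : ℝ) : ι (free s f) φ = inner ℂ (toL2 (conj φ)) (freeL2 s (toL2 f)) := by
      rw [← toL2_free, ← ι_conj, conj_conj', ι_comm]
    have e2 : schrodingerOp (free t f) φ
        = -Complex.I * inner ℂ (dx (conj φ)) (freeL2 t (dx f)) := by
      rw [← dx_free, ← dform_conj, conj_conj', schrodingerOp_apply, dform_comm]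
    simp_rw [e1, e2]
    exact this

/-- If `z` is differentiable in `H¹`, then `free t (z t)` is differentiable in `H⁻¹`. -/
theorem hasDerivAt_ι_free_comp {z : ℝ → H1} {z' : H1} {t : ℝ} (hz : HasDerivAt z z' t) :
    HasDerivAt (fun s => ι (free s (z s)))
      (schrodingerOp (free t (z t)) + ι (free t z')) t := by
  have h1 := hasDerivAt_ι_free (z t) t
  -- The increment vanishes at s = t, so its slope is the group applied to the slope of z, which
  -- converges already in H¹.
  have h2 : HasDerivAt (fun s => ι (free s (z s - z t))) (ι (free t z')) t := by
    rw [hasDerivAt_iff_tendsto_slope] at hz ⊢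
    have h3 : Tendsto (fun s => free s (slope z t s)) (𝓝[≠] t) (𝓝 (free t z')) :=
      tendsto_free (tendsto_id.mono_left nhdsWithin_le_nhds) hz
    refine ((ι.continuous.tendsto _).comp h3).congr fun s => ?_
    rw [Function.comp_apply, slope_def_module, slope_def_module, sub_self, map_zero, map_zero,
      sub_zero]
    rw [← Complex.coe_smul, ← Complex.coe_smul, map_smul, map_smul]
  have h := h1.add h2
  have e : (fun s => ι (free s (z s)))
      = (fun s => ι (free s (z t))) + fun s => ι (free s (z s - z t)) := by
    funext s
    rw [Pi.add_apply, ← map_add, ← map_add, add_sub_cancel]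
  rw [e]
  exact h

end PTNLS
end

/-! ### Ordinary differential equations in Banach spaces, and Grönwall's inequality. -/

noncomputable section

namespace PTNLS

open Filter Topology Set Metric
open scoped NNReal

section ODE

variable {E : Type*} [NormedAddCommGroup E]

/-- In time T a field bounded by L moves a point by at most L T, so Picard–Lindelöf on the ball of
that radius covers the whole interval. -/
theorem exists_solution_of_bounded [NormedSpace ℝ E] [CompleteSpace E] {f : ℝ → E → E} {K L : ℝ≥0}
    (hlip : ∀ t, LipschitzWith K (f t)) (hcont : ∀ x, Continuous fun t => f t x)
    (hbd : ∀ t x, ‖f t x‖ ≤ L) (x₀ : E) {T : ℝ} (hT : 0 ≤ T) :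
    ∃ z : ℝ → E, z 0 = x₀ ∧ ContinuousOn z (Icc (-T) T) ∧
      ∀ t ∈ Ioo (-T) T, HasDerivAt z (f t (z t)) t := by
  have h0 : (0 : ℝ) ∈ Icc (-T) T := ⟨by linarith, hT⟩
  have h : IsPicardLindelof f (⟨0, h0⟩ : Icc (-T) T) x₀ (L * ⟨T, hT⟩) 0 L K :=
    { lipschitzOnWith := fun t _ => (hlip t).lipschitzOnWith
      continuousOn := fun x _ => (hcont x).continuousOn
      norm_le := fun t _ x _ => hbd t x
      mul_max_le := by
        simp only [sub_zero, zero_sub, neg_neg, max_self, NNReal.coe_zero]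
        rfl }
  obtain ⟨z, hz0, hz⟩ := h.exists_eq_forall_mem_Icc_hasDerivWithinAt₀
  exact ⟨z, hz0, fun t ht => (hz t ht).continuousWithinAt,
    fun t ht => (hz t (Ioo_subset_Icc_self ht)).hasDerivAt (Icc_mem_nhds ht.1 ht.2)⟩

/-- A cutoff function that is `1` on the ball of radius `R` and `0` outside that of radius `R + 1`. -/
def cutoff (R : ℝ) (x : E) : ℝ := max 0 (min 1 (R + 1 - ‖x‖))

theorem cutoff_nonneg (R : ℝ) (x : E) : 0 ≤ cutoff R x := le_max_left _ _

theorem cutoff_le_one (R : ℝ) (x : E) : cutoff R x ≤ 1 := max_le zero_le_one (min_le_left _ _)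

theorem cutoff_eq_one {R : ℝ} {x : E} (h : ‖x‖ ≤ R) : cutoff R x = 1 := by
  rw [cutoff, min_eq_left (by linarith), max_eq_right zero_le_one]

theorem cutoff_eq_zero {R : ℝ} {x : E} (h : R + 1 ≤ ‖x‖) : cutoff R x = 0 :=
  max_eq_left ((min_le_right _ _).trans (by linarith))

theorem abs_cutoff_sub_le (R : ℝ) (x y : E) : |cutoff R x - cutoff R y| ≤ ‖x - y‖ := by
  have h := abs_norm_sub_norm_le x y
  have h1 := abs_max_sub_max_le_abs (min 1 (R + 1 - ‖x‖)) (min 1 (R + 1 - ‖y‖)) 0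
  have h2 := abs_min_sub_min_le_max 1 (R + 1 - ‖x‖) 1 (R + 1 - ‖y‖)
  rw [max_comm, max_comm _ (0 : ℝ)] at h1
  refine h1.trans (h2.trans ?_)
  rw [sub_self, abs_zero, max_eq_right (abs_nonneg _), sub_sub_sub_cancel_left, abs_sub_comm]
  exact h

variable [NormedSpace ℝ E]

/-- Inside the larger ball this is the product estimate. If y lies outside, its cutoff is 0, so the
cutoff at x is at most ‖x - y‖. -/
theorem lipschitzWith_cutoff_smul {f : E → E} {R : ℝ} {K M : ℝ≥0}
    (hlip : LipschitzOnWith K f (closedBall 0 (R + 1)))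
    (hbd : ∀ x ∈ closedBall (0 : E) (R + 1), ‖f x‖ ≤ M) :
    LipschitzWith (K + M) fun x => cutoff R x • f x := by
  have out {x y : E} (hx : x ∈ closedBall (0 : E) (R + 1)) (hy : y ∉ closedBall (0 : E) (R + 1)) :
      ‖cutoff R x • f x - cutoff R y • f y‖ ≤ (K + M) * ‖x - y‖ := by
    rw [mem_closedBall_zero_iff, not_le] at hy
    have h1 := abs_cutoff_sub_le R x y
    rw [cutoff_eq_zero hy.le, sub_zero] at h1
    rw [cutoff_eq_zero hy.le, zero_smul, sub_zero, norm_smul, Real.norm_eq_abs]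
    have := mul_le_mul h1 (hbd x hx) (norm_nonneg _) (norm_nonneg _)
    nlinarith [K.2, norm_nonneg (x - y), mul_nonneg K.2 (norm_nonneg (x - y))]
  refine LipschitzWith.of_dist_le_mul fun x y => ?_
  rw [dist_eq_norm, dist_eq_norm, NNReal.coe_add]
  by_cases hx : x ∈ closedBall (0 : E) (R + 1) <;> by_cases hy : y ∈ closedBall (0 : E) (R + 1)
  · have e : cutoff R x • f x - cutoff R y • f y
        = cutoff R x • (f x - f y) + (cutoff R x - cutoff R y) • f y := by module
    rw [e]
    refine (norm_add_le _ _).trans ?_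
    rw [norm_smul, norm_smul, Real.norm_of_nonneg (cutoff_nonneg R x), Real.norm_eq_abs, add_mul]
    have h1 := hlip.dist_le_mul x hx y hy
    rw [dist_eq_norm, dist_eq_norm] at h1
    refine add_le_add ?_ ?_
    · exact (mul_le_of_le_one_left (norm_nonneg _) (cutoff_le_one R x)).trans h1
    · rw [mul_comm]
      exact mul_le_mul (hbd y hy) (abs_cutoff_sub_le R x y) (abs_nonneg _) M.2
  · exact out hx hy
  · rw [norm_sub_rev, norm_sub_rev x]
    exact out hy hx
  · rw [mem_closedBall_zero_iff, not_le] at hx hy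
    rw [cutoff_eq_zero hx.le, cutoff_eq_zero hy.le, zero_smul, zero_smul, sub_zero, norm_zero]
    positivity

variable {f : ℝ → E → E}

/-- Solve the truncated equation. Until the solution reaches norm R it solves the true equation, so
the a priori bound keeps it below B T, and by continuity it never reaches R. -/
theorem exists_solution_Ioo [CompleteSpace E]
    (hlip : ∀ R : ℝ, ∃ K : ℝ≥0, ∀ t, LipschitzOnWith K (f t) (closedBall 0 R))
    (hbd : ∀ R : ℝ, ∃ M : ℝ≥0, ∀ t, ∀ x ∈ closedBall (0 : E) R, ‖f t x‖ ≤ M)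
    (hcont : ∀ x, Continuous fun t => f t x) {x₀ : E} {B : ℝ → ℝ} (hB : Monotone B)
    (hx₀ : ‖x₀‖ ≤ B 0)
    (hapriori : ∀ T > 0, ∀ z : ℝ → E, z 0 = x₀ → (∀ t ∈ Ioo (-T) T, HasDerivAt z (f t (z t)) t) →
      ∀ t ∈ Ioo (-T) T, ‖z t‖ ≤ B |t|) {T : ℝ} (hT : 0 < T) :
    ∃ z : ℝ → E, z 0 = x₀ ∧ ∀ t ∈ Ioo (-T) T, HasDerivAt z (f t (z t)) t := by
  -- The margin 1 over B T is what makes reaching R contradictory.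
  set R := B T + 1 with hR
  obtain ⟨K, hK⟩ := hlip (R + 1)
  obtain ⟨M, hM⟩ := hbd (R + 1)
  have hbd' (t : ℝ) (x : E) : ‖cutoff R x • f t x‖ ≤ M := by
    rw [norm_smul, Real.norm_of_nonneg (cutoff_nonneg R x)]
    by_cases hx : x ∈ closedBall (0 : E) (R + 1)
    · exact (mul_le_of_le_one_left (norm_nonneg _) (cutoff_le_one R x)).trans (hM t x hx)
    · rw [mem_closedBall_zero_iff, not_le] at hx
      rw [cutoff_eq_zero hx.le, zero_mul]
      exact M.2
  obtain ⟨z, hz0, hzc, hz⟩ := exists_solution_of_bounded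
    (fun t => lipschitzWith_cutoff_smul (hK t) (hM t)) (fun x => (hcont x).const_smul _) hbd' x₀ hT.le
  have hlt : ∀ t ∈ Icc (-T) T, ‖z t‖ < R := by
    by_contra! hne
    let A : Set ℝ := {t ∈ Icc (-T) T | R ≤ ‖z t‖}
    have hA : IsCompact A :=
      isCompact_Icc.of_isClosed_subset
        (hzc.norm.preimage_isClosed_of_isClosed isClosed_Icc isClosed_Ici) (sep_subset _ _)
    -- Minimizing |t| finds the first exit in both time directions at once.
    obtain ⟨s, hsA, hmin⟩ := hA.exists_isMinOn hne continuous_abs.continuousOn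
    have hsT : |s| ≤ T := abs_le.2 hsA.1
    have hs0 : 0 < |s| := by
      rw [abs_pos]
      rintro rfl
      have h1 := hsA.2
      have h2 := hB hT.le
      rw [hz0] at h1
      linarith
    have hsol (t : ℝ) (ht : t ∈ Ioo (-|s|) |s|) : HasDerivAt z (f t (z t)) t := by
      have htT : t ∈ Ioo (-T) T := ⟨by linarith [ht.1], by linarith [ht.2]⟩
      have hnot : t ∉ A := fun h => absurd (hmin h) (not_le.2 (abs_lt.2 ht))
      have : ‖z t‖ ≤ R := by
        by_contra! h
        exact hnot ⟨Ioo_subset_Icc_self htT, h.le⟩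
      have h := hz t htT
      rwa [cutoff_eq_one this, one_smul] at h
    have hle (t : ℝ) (ht : t ∈ Ioo (-|s|) |s|) : ‖z t‖ ≤ B T :=
      (hapriori |s| hs0 z hz0 hsol t ht).trans (hB ((abs_lt.2 ht).le.trans hsT))
    have hcl : s ∈ closure (Ioo (-|s|) |s|) := by
      rw [closure_Ioo (by linarith)]
      exact abs_le.1 le_rfl
    have hsub : Ioo (-|s|) |s| ⊆ Icc (-T) T := fun t ht => ⟨by linarith [ht.1], by linarith [ht.2]⟩
    have hzs := ((hzc s hsA.1).mono hsub).norm
    have := ContinuousWithinAt.closure_le hcl hzs continuousWithinAt_const hle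
    have := hsA.2
    linarith
  refine ⟨z, hz0, fun t ht => ?_⟩
  have h := hz t ht
  rwa [cutoff_eq_one (hlt t (Ioo_subset_Icc_self ht)).le, one_smul] at h

theorem solution_eqOn_Ioo (hlip : ∀ R : ℝ, ∃ K : ℝ≥0, ∀ t, LipschitzOnWith K (f t) (closedBall 0 R))
    {B : ℝ → ℝ} (hB : Monotone B) {T : ℝ} (hT : 0 < T) {z₁ z₂ : ℝ → E}
    (h₁ : ∀ t ∈ Ioo (-T) T, HasDerivAt z₁ (f t (z₁ t)) t)
    (h₂ : ∀ t ∈ Ioo (-T) T, HasDerivAt z₂ (f t (z₂ t)) t)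
    (hb₁ : ∀ t ∈ Ioo (-T) T, ‖z₁ t‖ ≤ B |t|) (hb₂ : ∀ t ∈ Ioo (-T) T, ‖z₂ t‖ ≤ B |t|)
    (h0 : z₁ 0 = z₂ 0) : EqOn z₁ z₂ (Ioo (-T) T) := by
  obtain ⟨K, hK⟩ := hlip (B T)
  have hmem {z : ℝ → E} (hb : ∀ t ∈ Ioo (-T) T, ‖z t‖ ≤ B |t|) (t : ℝ) (ht : t ∈ Ioo (-T) T) :
      z t ∈ closedBall (0 : E) (B T) :=
    mem_closedBall_zero_iff.2 ((hb t ht).trans (hB (abs_lt.2 ht).le))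
  exact ODE_solution_unique_of_mem_Ioo (s := fun _ => closedBall 0 (B T)) (fun t _ => hK t)
    (t₀ := 0) ⟨by linarith, hT⟩ (fun t ht => ⟨h₁ t ht, hmem hb₁ t ht⟩)
    (fun t ht => ⟨h₂ t ht, hmem hb₂ t ht⟩) h0

/-- Global existence for an ordinary differential equation with an a priori bound. -/
theorem exists_global_solution [CompleteSpace E]
    (hlip : ∀ R : ℝ, ∃ K : ℝ≥0, ∀ t, LipschitzOnWith K (f t) (closedBall 0 R))
    (hbd : ∀ R : ℝ, ∃ M : ℝ≥0, ∀ t, ∀ x ∈ closedBall (0 : E) R, ‖f t x‖ ≤ M)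
    (hcont : ∀ x, Continuous fun t => f t x) {x₀ : E} {B : ℝ → ℝ} (hB : Monotone B)
    (hx₀ : ‖x₀‖ ≤ B 0)
    (hapriori : ∀ T > 0, ∀ z : ℝ → E, z 0 = x₀ → (∀ t ∈ Ioo (-T) T, HasDerivAt z (f t (z t)) t) →
      ∀ t ∈ Ioo (-T) T, ‖z t‖ ≤ B |t|) :
    ∃ z : ℝ → E, z 0 = x₀ ∧ ∀ t, HasDerivAt z (f t (z t)) t := by
  have hex (T : ℝ) (hT : 0 < T) := exists_solution_Ioo hlip hbd hcont hB hx₀ hapriori hT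
  have hpos (t : ℝ) : 0 < |t| + 1 := by positivity
  choose! Z hZ0 hZ using hex
  -- The interval varies with t; uniqueness shows that near t all these solutions agree with the
  -- single one of radius |t| + 2.
  refine ⟨fun t => Z (|t| + 1) t, hZ0 _ (hpos 0), fun t => ?_⟩
  have hev : (fun s => Z (|s| + 1) s) =ᶠ[𝓝 t] Z (|t| + 1 + 1) := by
    have hS : Ioo (-(|t| + 1)) (|t| + 1) ∈ 𝓝 t := by
      apply Ioo_mem_nhds <;> linarith [neg_abs_le t, le_abs_self t]
    filter_upwards [hS] with s hs
    have hs1 : |s| < |t| + 1 := abs_lt.2 hs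
    have hsub : Ioo (-(|s| + 1)) (|s| + 1) ⊆ Ioo (-(|t| + 1 + 1)) (|t| + 1 + 1) :=
      Ioo_subset_Ioo (by linarith) (by linarith)
    have h2 : 0 < |t| + 1 + 1 := by positivity
    refine solution_eqOn_Ioo hlip hB (hpos s) (hZ _ (hpos s))
      (fun r hr => hZ _ h2 r (hsub hr))
      (hapriori _ (hpos s) _ (hZ0 _ (hpos s)) (hZ _ (hpos s)))
      (fun r hr => hapriori _ h2 _ (hZ0 _ h2) (hZ _ h2) r (hsub hr))
      ((hZ0 _ (hpos s)).trans (hZ0 _ h2).symm) ?_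
    exact abs_lt.1 (by linarith)
  have ht : t ∈ Ioo (-(|t| + 1 + 1)) (|t| + 1 + 1) := abs_lt.1 (by linarith)
  have h := hZ (|t| + 1 + 1) (by positivity) t ht
  have e := hev.eq_of_nhds
  rw [← e] at h
  exact h.congr_of_eventuallyEq hev

/-- A nonnegative quantity whose logarithmic derivative is at most `K` grows at most like
`exp (K |t|)`. -/
theorem le_mul_exp_of_abs_deriv_le {Y Y' : ℝ → ℝ} {K T : ℝ}
    (hY : ∀ t ∈ Ioo (-T) T, HasDerivAt Y (Y' t) t) (hle : ∀ t ∈ Ioo (-T) T, |Y' t| ≤ K * Y t)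
    {t : ℝ} (ht : t ∈ Ioo (-T) T) : Y t ≤ Y 0 * Real.exp (K * |t|) := by
  have h0 : (0 : ℝ) ∈ Ioo (-T) T := ⟨by linarith [ht.1, ht.2], by linarith [ht.1, ht.2]⟩
  have hd (σ : ℝ) (s : ℝ) (hs : s ∈ Ioo (-T) T) : HasDerivAt (fun s => Y s * Real.exp (σ * s))
      (Y' s * Real.exp (σ * s) + Y s * (Real.exp (σ * s) * σ)) s := by
    have h1 : HasDerivAt (fun s : ℝ => σ * s) σ s := by
      simpa using (hasDerivAt_id s).const_mul σ
    exact (hY s hs).mul h1.exp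
  rcases le_total 0 t with h | h
  · have hanti : AntitoneOn (fun s => Y s * Real.exp (-K * s)) (Ioo (-T) T) := by
      refine antitoneOn_of_hasDerivWithinAt_nonpos (convex_Ioo _ _)
        (fun s hs => (hd _ s hs).continuousAt.continuousWithinAt)
        (fun s hs => (hd (-K) s (interior_subset hs)).hasDerivWithinAt) fun s hs => ?_
      have := (abs_le.1 (hle s (interior_subset hs))).2
      have e := Real.exp_pos (-K * s)
      nlinarith
    have := hanti h0 ht h
    simp only [mul_zero, Real.exp_zero, mul_one] at this
    rw [abs_of_nonneg h]
    have e : Real.exp (-K * t) * Real.exp (K * t) = 1 := by rw [← Real.exp_add]; simp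
    calc Y t = Y t * Real.exp (-K * t) * Real.exp (K * t) := by rw [mul_assoc, e, mul_one]
      _ ≤ _ := by gcongr
  · have hmono : MonotoneOn (fun s => Y s * Real.exp (K * s)) (Ioo (-T) T) := by
      refine monotoneOn_of_hasDerivWithinAt_nonneg (convex_Ioo _ _)
        (fun s hs => (hd _ s hs).continuousAt.continuousWithinAt)
        (fun s hs => (hd K s (interior_subset hs)).hasDerivWithinAt) fun s hs => ?_
      have := (abs_le.1 (hle s (interior_subset hs))).1
      have e := Real.exp_pos (K * s)
      nlinarith
    have := hmono ht h0 h
    simp only [mul_zero, Real.exp_zero, mul_one] at this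
    rw [abs_of_nonpos h]
    have e : Real.exp (K * t) * Real.exp (K * -t) = 1 := by rw [← Real.exp_add]; simp
    calc Y t = Y t * Real.exp (K * t) * Real.exp (K * -t) := by rw [mul_assoc, e, mul_one]
      _ ≤ _ := by gcongr

end ODE

end PTNLS
end

/-! ### The nonlinearity and the interaction picture. -/

noncomputable section

namespace PTNLS

open Filter Topology Set Metric
open scoped NNReal

/-- The real potential `a |u|² + b |v|²`. -/
def potential (a b : ℝ) (u v : H1) : H1 :=
  (a : ℂ) • mul u (conj u) + (b : ℂ) • mul v (conj v)

/-- The part `-i κ v + γ u + i (a |u|² + b |v|²) u` of order zero of the evolution equation. -/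
def field (κ γ a b : ℝ) (u v : H1) : H1 :=
  (-Complex.I * κ) • v + (γ : ℂ) • u + Complex.I • mul u (potential a b u v)

theorem rhs_eq (κ γ a b : ℝ) (u v φ : H1) :
    rhs κ γ a b u v φ = dform u φ + Complex.I * ι (field κ γ a b u v) φ := by
  have e1 : ι (mul u (potential a b u v)) φ
      = ∫ x, ((a * ‖toL2 u x‖ ^ 2 + b * ‖toL2 v x‖ ^ 2 : ℝ) : ℂ) * toL2 u x * toL2 φ x := by
    rw [ι_apply, pairL2_apply]
    apply integral_congr_ae
    have h0 : toL2 (potential a b u v)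
        = (a : ℂ) • toL2 (mul u (conj u)) + (b : ℂ) • toL2 (mul v (conj v)) := by
      rw [potential, map_add, map_smul, map_smul]
    filter_upwards [coeFn_toL2_mul u (potential a b u v), coeFn_toL2_mul u (conj u),
      coeFn_toL2_mul v (conj v), coeFn_toL2_conj u, coeFn_toL2_conj v,
      Lp.coeFn_add ((a : ℂ) • toL2 (mul u (conj u))) ((b : ℂ) • toL2 (mul v (conj v))),
      Lp.coeFn_smul (a : ℂ) (toL2 (mul u (conj u))),
      Lp.coeFn_smul (b : ℂ) (toL2 (mul v (conj v)))] with x h1 h2 h3 h4 h5 h6 h7 h8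
    rw [h1, h0, h6, Pi.add_apply, h7, h8, Pi.smul_apply, Pi.smul_apply, h2, h3, h4, h5,
      Complex.mul_conj', Complex.mul_conj']
    push_cast
    simp only [smul_eq_mul]
    ring
  have e2 (f g : H1) : ∫ x, toL2 f x * toL2 g x = ι f g := by rw [ι_apply, pairL2_apply]
  have e3 : ∫ x, dx u x * dx φ x = dform u φ := by rw [dform_apply, pairL2_apply]
  rw [rhs, ← e1, e2, e2, e3, field]
  simp only [map_add, map_smul, add_apply, smul_apply, smul_eq_mul]
  linear_combination (κ * ι v φ - ι (mul u (potential a b u v)) φ) * Complex.I_sq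

/-- Dividing by i puts the weak equations in evolution form, with everything except i ∂ₓ² given by
an element of H¹. -/
theorem isGlobalSolution_iff {κ γ g₁₁ g₂₂ g₁₂ : ℝ} {w : C(ℝ, H1 × H1)} :
    IsGlobalSolution κ γ g₁₁ g₂₂ g₁₂ w ↔ ∀ t,
      HasDerivAt (fun s => ι (w s).1)
        (schrodingerOp (w t).1 + ι (field κ γ g₁₁ g₁₂ (w t).1 (w t).2)) t ∧
      HasDerivAt (fun s => ι (w s).2)
        (schrodingerOp (w t).2 + ι (field κ (-γ) g₂₂ g₁₂ (w t).2 (w t).1)) t := by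
  have key (κ γ a b : ℝ) (u v : H1) (L : HNeg1) :
      (∀ φ, Complex.I * L φ = rhs κ γ a b u v φ) ↔
        L = schrodingerOp u + ι (field κ γ a b u v) := by
    simp only [rhs_eq]
    constructor
    · intro h
      ext φ
      rw [add_apply, schrodingerOp_apply]
      linear_combination -Complex.I * h φ + (L φ - ι (field κ γ a b u v) φ) * Complex.I_sq
    · rintro rfl φ
      rw [add_apply, schrodingerOp_apply]
      linear_combination (-dform u φ) * Complex.I_sq
  constructor
  · intro h t
    obtain ⟨ut, h1, h2⟩ := h.eq_u t
    obtain ⟨vt, h3, h4⟩ := h.eq_v t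
    rw [key] at h2 h4
    subst h2 h4
    exact ⟨h1, h3⟩
  · intro h
    exact ⟨fun t => ⟨_, (h t).1, (key _ _ _ _ _ _ _).2 rfl⟩,
      fun t => ⟨_, (h t).2, (key _ _ _ _ _ _ _).2 rfl⟩⟩

theorem norm_potential_le {a b R : ℝ} {u v : H1} (hu : ‖u‖ ≤ R) (hv : ‖v‖ ≤ R) :
    ‖potential a b u v‖ ≤ 3 * R ^ 2 * (|a| + |b|) := by
  have h (f : H1) (hf : ‖f‖ ≤ R) : ‖mul f (conj f)‖ ≤ 3 * R ^ 2 := by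
    refine (norm_mul_le' _ _).trans ?_
    rw [norm_conj']
    nlinarith [norm_nonneg f]
  refine (norm_add_le _ _).trans ?_
  rw [norm_smul, norm_smul, Complex.norm_real, Complex.norm_real, Real.norm_eq_abs, Real.norm_eq_abs]
  have h1 := mul_le_mul_of_nonneg_left (h u hu) (abs_nonneg a)
  have h2 := mul_le_mul_of_nonneg_left (h v hv) (abs_nonneg b)
  linarith

section Lipschitz

variable {p : Seminorm ℂ H1}

theorem seminorm_mul_le (hmul : ∀ f g, p (mul f g) ≤ 3 * ‖f‖ * p g) {R : ℝ} {f : H1} (hf : ‖f‖ ≤ R) (g : H1) : p (mul f g) ≤ 3 * R * p g :=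
  (hmul f g).trans (by gcongr)

/-- One telescoping estimate serves two norms: p is the H¹ norm for solving the equation and the L²
norm for uniqueness. The constant is 27 = 3 · 6 + 3 · 3, from the difference of the potentials and
from the difference of the factors u. -/
theorem seminorm_field_sub_le (hmul : ∀ f g, p (mul f g) ≤ 3 * ‖f‖ * p g)
    (hconj : ∀ f, p (conj f) = p f) (κ γ a b : ℝ) {R : ℝ} {u v u' v' : H1} (hu : ‖u‖ ≤ R) (hv : ‖v‖ ≤ R)
    (hu' : ‖u'‖ ≤ R) (hv' : ‖v'‖ ≤ R) :
    p (field κ γ a b u v - field κ γ a b u' v')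
      ≤ (|κ| + |γ| + 27 * R ^ 2 * (|a| + |b|)) * (p (u - u') + p (v - v')) := by
  have hR : 0 ≤ R := (norm_nonneg u).trans hu
  have hsq {f f' : H1} (hf : ‖f‖ ≤ R) (hf' : ‖f'‖ ≤ R) :
      p (mul f (conj f) - mul f' (conj f')) ≤ 6 * R * p (f - f') := by
    have e : mul f (conj f) - mul f' (conj f')
        = mul f (conj (f - f')) + mul (conj f') (f - f') := by
      rw [mul_comm' (conj f')]
      simp only [map_sub, sub_apply]
      abel
    rw [e]
    refine (map_add_le_add p _ _).trans ?_
    have h1 := seminorm_mul_le hmul hf (conj (f - f'))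
    have h2 := seminorm_mul_le hmul ((norm_conj' f').trans_le hf') (f - f')
    rw [hconj] at h1
    linarith
  have hpot : p (potential a b u v - potential a b u' v')
      ≤ 6 * R * (|a| + |b|) * (p (u - u') + p (v - v')) := by
    have e : potential a b u v - potential a b u' v'
        = (a : ℂ) • (mul u (conj u) - mul u' (conj u'))
          + (b : ℂ) • (mul v (conj v) - mul v' (conj v')) := by
      unfold potential
      module
    rw [e]
    refine (map_add_le_add p _ _).trans ?_
    rw [map_smul_eq_mul, map_smul_eq_mul, Complex.norm_real, Complex.norm_real, Real.norm_eq_abs,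
      Real.norm_eq_abs]
    have h1 := mul_le_mul_of_nonneg_left (hsq hu hu') (abs_nonneg a)
    have h2 := mul_le_mul_of_nonneg_left (hsq hv hv') (abs_nonneg b)
    have h3 : 0 ≤ R * |a| * p (v - v') :=
      mul_nonneg (mul_nonneg hR (abs_nonneg _)) (apply_nonneg p _)
    have h4 : 0 ≤ R * |b| * p (u - u') :=
      mul_nonneg (mul_nonneg hR (abs_nonneg _)) (apply_nonneg p _)
    linarith
  have e : field κ γ a b u v - field κ γ a b u' v'
      = (-Complex.I * κ) • (v - v') + (γ : ℂ) • (u - u')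
        + Complex.I • (mul u (potential a b u v - potential a b u' v')
          + mul (potential a b u' v') (u - u')) := by
    unfold field
    rw [mul_comm' (potential a b u' v')]
    simp only [map_sub, sub_apply]
    module
  rw [e]
  have h1 := seminorm_mul_le hmul hu (potential a b u v - potential a b u' v')
  have h2 := seminorm_mul_le hmul (norm_potential_le (a := a) (b := b) hu' hv') (u - u')
  have h3 := map_add_le_add p ((-Complex.I * κ) • (v - v') + (γ : ℂ) • (u - u'))
    (Complex.I • (mul u (potential a b u v - potential a b u' v')
          + mul (potential a b u' v') (u - u')))
  have h4 := map_add_le_add p ((-Complex.I * κ) • (v - v')) ((γ : ℂ) • (u - u'))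
  have h5 := map_add_le_add p (mul u (potential a b u v - potential a b u' v'))
    (mul (potential a b u' v') (u - u'))
  simp only [map_smul_eq_mul, norm_mul, norm_neg, Complex.norm_I, one_mul, Complex.norm_real,
    Real.norm_eq_abs] at h3 h4
  have h6 := mul_le_mul_of_nonneg_left hpot (by positivity : 0 ≤ 3 * R)
  have h7 : 0 ≤ |κ| * p (u - u') := mul_nonneg (abs_nonneg _) (apply_nonneg p _)
  have h8 : 0 ≤ |γ| * p (v - v') := mul_nonneg (abs_nonneg _) (apply_nonneg p _)
  have h9 : 0 ≤ R ^ 2 * (|a| + |b|) * p (v - v') := mul_nonneg (by positivity) (apply_nonneg p _)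
  linarith

end Lipschitz

theorem norm_field_sub_le (κ γ a b : ℝ) {R : ℝ} {u v u' v' : H1} (hu : ‖u‖ ≤ R) (hv : ‖v‖ ≤ R)
    (hu' : ‖u'‖ ≤ R) (hv' : ‖v'‖ ≤ R) :
    ‖field κ γ a b u v - field κ γ a b u' v'‖
      ≤ (|κ| + |γ| + 27 * R ^ 2 * (|a| + |b|)) * (‖u - u'‖ + ‖v - v'‖) :=
  seminorm_field_sub_le (p := normSeminorm ℂ H1) norm_mul_le' norm_conj' κ γ a b hu hv hu' hv'

theorem norm_toL2_field_sub_le (κ γ a b : ℝ) {R : ℝ} {u v u' v' : H1} (hu : ‖u‖ ≤ R)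
    (hv : ‖v‖ ≤ R) (hu' : ‖u'‖ ≤ R) (hv' : ‖v'‖ ≤ R) :
    ‖toL2 (field κ γ a b u v - field κ γ a b u' v')‖
      ≤ (|κ| + |γ| + 27 * R ^ 2 * (|a| + |b|)) * (‖toL2 (u - u')‖ + ‖toL2 (v - v')‖) := by
  refine seminorm_field_sub_le (p := (normSeminorm ℂ L2).comp (toL2 : H1 →ₗ[ℂ] L2))
    (fun f g => ?_) (fun f => ?_) κ γ a b hu hv hu' hv'
  · change ‖toL2 (mul f g)‖ ≤ 3 * ‖f‖ * ‖toL2 g‖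
    refine (norm_toL2_mul_le f g).trans ?_
    gcongr
    linarith [norm_toLinf_le f, norm_nonneg f]
  · exact norm_conjL2 _

theorem field_zero (κ γ a b : ℝ) : field κ γ a b 0 0 = 0 := by simp [field]

/-- The free Schrödinger group on pairs. -/
def freePair (t : ℝ) (w : H1 × H1) : H1 × H1 := (free t w.1, free t w.2)

/-- The part of order zero of the system. -/
def fieldPair (κ γ g₁₁ g₂₂ g₁₂ : ℝ) (w : H1 × H1) : H1 × H1 :=
  (field κ γ g₁₁ g₁₂ w.1 w.2, field κ (-γ) g₂₂ g₁₂ w.2 w.1)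

theorem fieldPair_zero (κ γ g₁₁ g₂₂ g₁₂ : ℝ) : fieldPair κ γ g₁₁ g₂₂ g₁₂ 0 = 0 := by
  simp [fieldPair, field_zero]

theorem norm_freePair (t : ℝ) (w : H1 × H1) : ‖freePair t w‖ = ‖w‖ := by
  simp [freePair, Prod.norm_def, norm_free]

theorem freePair_sub (t : ℝ) (w w' : H1 × H1) :
    freePair t w - freePair t w' = freePair t (w - w') := by
  simp [freePair]

theorem tendsto_freePair {X : Type*} {l : Filter X} {τ : X → ℝ} {z : X → H1 × H1} {t : ℝ}
    {f : H1 × H1} (hτ : Tendsto τ l (𝓝 t)) (hz : Tendsto z l (𝓝 f)) :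
    Tendsto (fun x => freePair (τ x) (z x)) l (𝓝 (freePair t f)) :=
  (tendsto_free hτ ((continuous_fst.tendsto _).comp hz)).prodMk_nhds
    (tendsto_free hτ ((continuous_snd.tendsto _).comp hz))

theorem continuous_fieldPair (κ γ g₁₁ g₂₂ g₁₂ : ℝ) : Continuous (fieldPair κ γ g₁₁ g₂₂ g₁₂) := by
  unfold fieldPair field potential
  fun_prop

theorem norm_fieldPair_sub_le (κ γ g₁₁ g₂₂ g₁₂ : ℝ) {R : ℝ} {w w' : H1 × H1} (hw : ‖w‖ ≤ R)
    (hw' : ‖w'‖ ≤ R) : ‖fieldPair κ γ g₁₁ g₂₂ g₁₂ w - fieldPair κ γ g₁₁ g₂₂ g₁₂ w'‖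
      ≤ 2 * (|κ| + |γ| + 27 * R ^ 2 * (|g₁₁| + |g₂₂| + |g₁₂|)) * ‖w - w'‖ := by
  obtain ⟨hu, hv⟩ := norm_prod_le_iff.1 hw
  obtain ⟨hu', hv'⟩ := norm_prod_le_iff.1 hw'
  have h1 := norm_field_sub_le κ γ g₁₁ g₁₂ hu hv hu' hv'
  have h2 := norm_field_sub_le κ (-γ) g₂₂ g₁₂ hv hu hv' hu'
  have d1 : ‖w.1 - w'.1‖ ≤ ‖w - w'‖ := norm_fst_le (w - w')
  have d2 : ‖w.2 - w'.2‖ ≤ ‖w - w'‖ := norm_snd_le (w - w')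
  rw [abs_neg] at h2
  refine norm_prod_le_iff.2 ⟨h1.trans ?_, h2.trans ?_⟩
  · calc _ ≤ (|κ| + |γ| + 27 * R ^ 2 * (|g₁₁| + |g₂₂| + |g₁₂|)) * (‖w - w'‖ + ‖w - w'‖) := by
          gcongr
          linarith [abs_nonneg g₂₂]
      _ = _ := by ring
  · calc _ ≤ (|κ| + |γ| + 27 * R ^ 2 * (|g₁₁| + |g₂₂| + |g₁₂|)) * (‖w - w'‖ + ‖w - w'‖) := by
          gcongr ?_ * (?_)
          · gcongr
            linarith [abs_nonneg g₁₁]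
          · linarith
      _ = _ := by ring

/-- The vector field of the system in the interaction picture. -/
def interactionField (κ γ g₁₁ g₂₂ g₁₂ : ℝ) (t : ℝ) (z : H1 × H1) : H1 × H1 :=
  freePair (-t) (fieldPair κ γ g₁₁ g₂₂ g₁₂ (freePair t z))

/-- The group is linear and isometric, so the Lipschitz constant of the nonlinearity carries over
and does not depend on t. -/
theorem norm_interactionField_sub_le (κ γ g₁₁ g₂₂ g₁₂ t : ℝ) {R : ℝ} {z z' : H1 × H1}
    (hz : ‖z‖ ≤ R) (hz' : ‖z'‖ ≤ R) :
    ‖interactionField κ γ g₁₁ g₂₂ g₁₂ t z - interactionField κ γ g₁₁ g₂₂ g₁₂ t z'‖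
      ≤ 2 * (|κ| + |γ| + 27 * R ^ 2 * (|g₁₁| + |g₂₂| + |g₁₂|)) * ‖z - z'‖ := by
  rw [interactionField, interactionField, freePair_sub, norm_freePair, ← norm_freePair t (z - z'),
    ← freePair_sub]
  exact norm_fieldPair_sub_le _ _ _ _ _ (by rwa [norm_freePair]) (by rwa [norm_freePair])

theorem interactionField_zero (κ γ g₁₁ g₂₂ g₁₂ t : ℝ) :
    interactionField κ γ g₁₁ g₂₂ g₁₂ t 0 = 0 := by
  rw [← norm_eq_zero, interactionField, norm_freePair]
  have : freePair t 0 = 0 := by simp [freePair]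
  rw [this, fieldPair_zero, norm_zero]

theorem continuous_interactionField (κ γ g₁₁ g₂₂ g₁₂ : ℝ) (z : H1 × H1) :
    Continuous fun t => interactionField κ γ g₁₁ g₂₂ g₁₂ t z := by
  rw [continuous_iff_continuousAt]
  intro t
  exact tendsto_freePair (continuous_neg.tendsto t)
    (((continuous_fieldPair κ γ g₁₁ g₂₂ g₁₂).tendsto _).comp
      (tendsto_freePair tendsto_id tendsto_const_nhds))

end PTNLS
end

/-! ### Product rules in H⁻¹ and uniqueness. -/

noncomputable section

namespace PTNLS

open Filter Topology Set Metric
open scoped NNReal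

/-- The first argument vanishes at s = t, so y need only be continuous. This allows product rules
for factors differentiable merely in H⁻¹ but continuous in H¹. -/
theorem hasDerivAt_bilin_sub {X Y Z : Type*} [NormedAddCommGroup X] [NormedSpace ℂ X]
    [NormedAddCommGroup Y] [NormedSpace ℂ Y] [NormedAddCommGroup Z] [NormedSpace ℂ Z]
    (B : X →L[ℂ] Y →L[ℂ] Z) {x : ℝ → X} {x' : X} {y : ℝ → Y} {t : ℝ} (hx : HasDerivAt x x' t)
    (hy : ContinuousAt y t) : HasDerivAt (fun s => B (x s - x t) (y s)) (B x' (y t)) t := by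
  rw [hasDerivAt_iff_tendsto_slope] at hx ⊢
  have h : Tendsto (fun s => B (slope x t s) (y s)) (𝓝[≠] t) (𝓝 (B x' (y t))) :=
    ((isBoundedBilinearMap_apply (𝕜 := ℂ)).continuous.tendsto (B x', y t)).comp
      (((B.continuous.tendsto x').comp hx).prodMk_nhds
        (hy.tendsto.mono_left nhdsWithin_le_nhds))
  refine h.congr fun s => ?_
  rw [slope_def_module, slope_def_module, sub_self, map_zero, zero_apply,
    sub_zero, ← Complex.coe_smul, ← Complex.coe_smul, map_smul, smul_apply]

/-- By symmetry of ι, the increment is ι (u s - u t) (φ s) + ι (φ s - φ t) (u t), and each term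
pairs an H⁻¹ increment with an H¹ function. -/
theorem hasDerivAt_ι_apply {u φ : ℝ → H1} {u' φ' : HNeg1} {t : ℝ}
    (hu : HasDerivAt (fun s => ι (u s)) u' t) (hφ : HasDerivAt (fun s => ι (φ s)) φ' t)
    (hcφ : ContinuousAt φ t) :
    HasDerivAt (fun s => ι (u s) (φ s)) (u' (φ t) + φ' (u t)) t := by
  have h1 := hasDerivAt_bilin_sub (ContinuousLinearMap.id ℂ HNeg1) hu hcφ
  have h2 := hasDerivAt_bilin_sub (ContinuousLinearMap.id ℂ HNeg1) hφ
    (continuousAt_const (y := u t))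
  have h3 := (h1.add h2).add_const (ι (φ t) (u t))
  refine h3.congr_of_eventuallyEq (Eventually.of_forall fun s => ?_)
  simp only [ContinuousLinearMap.id_apply, sub_apply, Pi.add_apply]
  rw [ι_comm (φ s) (u t)]
  ring

theorem hasDerivAt_ι_mul {u v : ℝ → H1} {u' v' : HNeg1} {t : ℝ}
    (hu : HasDerivAt (fun s => ι (u s)) u' t) (hv : HasDerivAt (fun s => ι (v s)) v' t)
    (hcv : ContinuousAt v t) :
    HasDerivAt (fun s => ι (mul (u s) (v s))) (u' ∘L mul (v t) + v' ∘L mul (u t)) t := by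
  have hc : ContinuousAt (fun s => mul (v s)) t := (mul.continuous.continuousAt).comp hcv
  have h1 := hasDerivAt_bilin_sub (ContinuousLinearMap.compL ℂ H1 H1 ℂ) hu hc
  have h2 := hasDerivAt_bilin_sub (ContinuousLinearMap.compL ℂ H1 H1 ℂ) hv
    (continuousAt_const (y := mul (u t)))
  have h3 := (h1.add h2).add_const (ι (mul (v t) (u t)))
  refine h3.congr_of_eventuallyEq (Eventually.of_forall fun s => ?_)
  ext φ
  simp only [ContinuousLinearMap.compL_apply, Pi.add_apply, add_apply,
    ContinuousLinearMap.comp_apply, sub_apply, ← ι_mul]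
  rw [mul_comm' (v s) (u t)]
  ring

/-- Complex conjugation of an element of `H⁻¹`. -/
def conjFunctional (L : HNeg1) : HNeg1 :=
  LinearMap.mkContinuous
    { toFun := fun φ => starRingEnd ℂ (L (conj φ))
      map_add' := fun φ ψ => by simp
      map_smul' := fun c φ => by simp [conj_smul] }
    ‖L‖ fun φ => by
      change ‖starRingEnd ℂ (L (conj φ))‖ ≤ _
      rw [Complex.norm_conj, ← norm_conj' φ]
      exact L.le_opNorm _

/-- Complex conjugation on `H⁻¹`. -/
def conjDual : HNeg1 →L[ℝ] HNeg1 :=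
  LinearMap.mkContinuous
    { toFun := conjFunctional
      map_add' := fun L L' => by ext φ; simp [conjFunctional]
      map_smul' := fun c L => by ext φ; simp [conjFunctional] }
    1 fun L => by
      rw [one_mul]
      refine ContinuousLinearMap.opNorm_le_bound _ (norm_nonneg _) fun φ => ?_
      change ‖starRingEnd ℂ (L (conj φ))‖ ≤ _
      rw [Complex.norm_conj, ← norm_conj' φ]
      exact L.le_opNorm _

theorem conjDual_apply (L : HNeg1) (φ : H1) : conjDual L φ = starRingEnd ℂ (L (conj φ)) := rfl

theorem conjDual_ι (u : H1) : conjDual (ι u) = ι (conj u) := by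
  ext φ
  rw [conjDual_apply, conj_ι, conj_conj']

theorem hasDerivAt_ι_conj {u : ℝ → H1} {u' : HNeg1} {t : ℝ}
    (hu : HasDerivAt (fun s => ι (u s)) u' t) :
    HasDerivAt (fun s => ι (conj (u s))) (conjDual u') t := by
  simp_rw [← conjDual_ι]
  exact conjDual.hasFDerivAt.comp_hasDerivAt t hu

theorem norm_toL2_sq (u : H1) : ‖toL2 u‖ ^ 2 = (ι u (conj u)).re := by
  rw [ι_comm, ι_conj, inner_self_eq_norm_sq_to_K, ← RCLike.ofReal_pow,
    RCLike.ofReal_eq_complex_ofReal, Complex.ofReal_re]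

theorem dform_self_conj (u : H1) : dform u (conj u) = ((‖dx u‖ ^ 2 : ℝ) : ℂ) := by
  rw [dform_comm, dform_conj, inner_self_eq_norm_sq_to_K]
  norm_cast

theorem re_schrodingerOp_self (u : H1) : (schrodingerOp u (conj u)).re = 0 := by
  rw [schrodingerOp_apply, dform_self_conj]
  simp [-Complex.ofReal_pow]

theorem hasDerivAt_norm_toL2_sq {u : ℝ → H1} {u' : HNeg1} {t : ℝ}
    (hu : HasDerivAt (fun s => ι (u s)) u' t) (hc : ContinuousAt u t) :
    HasDerivAt (fun s => ‖toL2 (u s)‖ ^ 2) (2 * (u' (conj (u t))).re) t := by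
  have h := Complex.reCLM.hasFDerivAt.comp_hasDerivAt t (hasDerivAt_ι_apply hu
    (hasDerivAt_ι_conj hu) (conj.continuous.continuousAt.comp hc))
  simp_rw [norm_toL2_sq]
  refine h.congr_deriv ?_
  rw [conjDual_apply, Complex.reCLM_apply, Complex.add_re, Complex.conj_re]
  ring

/-- Grönwall for the squared L² distance: the Schrödinger operator contributes nothing to its
derivative, and the nonlinearity is Lipschitz in L² because both solutions are bounded in H¹ on
compact time intervals. -/
theorem solution_unique {κ γ g₁₁ g₂₂ g₁₂ : ℝ} {w₁ w₂ : C(ℝ, H1 × H1)}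
    (h₁ : IsGlobalSolution κ γ g₁₁ g₂₂ g₁₂ w₁) (h₂ : IsGlobalSolution κ γ g₁₁ g₂₂ g₁₂ w₂)
    (h0 : w₁ 0 = w₂ 0) : w₁ = w₂ := by
  rw [isGlobalSolution_iff] at h₁ h₂
  ext1 t
  set T := |t| + 1 with hT
  obtain ⟨R₁, hR₁⟩ := isCompact_Icc.exists_bound_of_continuousOn (s := Icc (-T) T)
    w₁.continuous.continuousOn
  obtain ⟨R₂, hR₂⟩ := isCompact_Icc.exists_bound_of_continuousOn (s := Icc (-T) T)
    w₂.continuous.continuousOn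
  set R := max R₁ R₂
  set C := |κ| + |γ| + 27 * R ^ 2 * (|g₁₁| + |g₂₂| + |g₁₂|) with hC
  have hC0 : 0 ≤ C := by positivity
  let a : ℝ → ℝ := fun s => ‖toL2 ((w₁ s).1 - (w₂ s).1)‖
  let b : ℝ → ℝ := fun s => ‖toL2 ((w₁ s).2 - (w₂ s).2)‖
  have hder (s : ℝ) (u₁ u₂ : ℝ → H1) (F₁ F₂ : H1) (c₁ : Continuous u₁) (c₂ : Continuous u₂)
      (d₁ : HasDerivAt (fun s => ι (u₁ s)) (schrodingerOp (u₁ s) + ι F₁) s)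
      (d₂ : HasDerivAt (fun s => ι (u₂ s)) (schrodingerOp (u₂ s) + ι F₂) s) :
      ∃ y, HasDerivAt (fun s => ‖toL2 (u₁ s - u₂ s)‖ ^ 2) y s ∧
        |y| ≤ 2 * (‖toL2 (F₁ - F₂)‖ * ‖toL2 (u₁ s - u₂ s)‖) := by
    have hd : HasDerivAt (fun s => ι (u₁ s - u₂ s))
        (schrodingerOp (u₁ s - u₂ s) + ι (F₁ - F₂)) s := by
      have e : (fun s => ι (u₁ s - u₂ s)) = (fun s => ι (u₁ s)) - fun s => ι (u₂ s) := by
        funext s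
        rw [map_sub, Pi.sub_apply]
      have e' : schrodingerOp (u₁ s - u₂ s) + ι (F₁ - F₂)
          = (schrodingerOp (u₁ s) + ι F₁) - (schrodingerOp (u₂ s) + ι F₂) := by
        rw [map_sub, map_sub]
        abel
      rw [e, e']
      exact d₁.sub d₂
    refine ⟨_, hasDerivAt_norm_toL2_sq hd (c₁.sub c₂).continuousAt, ?_⟩
    rw [add_apply, Complex.add_re, re_schrodingerOp_self, zero_add, abs_mul, abs_two]
    have h1 := (Complex.abs_re_le_norm _).trans (norm_ι_le (F₁ - F₂) (conj (u₁ s - u₂ s)))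
    rw [toL2_conj, norm_conjL2] at h1
    gcongr
  choose y₁ hy₁ hb₁ using fun s => hder s _ _ _ _ (by fun_prop) (by fun_prop) (h₁ s).1 (h₂ s).1
  choose y₂ hy₂ hb₂ using fun s => hder s _ _ _ _ (by fun_prop) (by fun_prop) (h₁ s).2 (h₂ s).2
  have hY (s : ℝ) : HasDerivAt (fun s => a s ^ 2 + b s ^ 2) (y₁ s + y₂ s) s := (hy₁ s).add (hy₂ s)
  have hle (s : ℝ) (hs : s ∈ Ioo (-T) T) : |y₁ s + y₂ s| ≤ 4 * C * (a s ^ 2 + b s ^ 2) := by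
    obtain ⟨i1, i2⟩ := norm_prod_le_iff.1
      ((hR₁ s (Ioo_subset_Icc_self hs)).trans (le_max_left R₁ R₂))
    obtain ⟨i3, i4⟩ := norm_prod_le_iff.1
      ((hR₂ s (Ioo_subset_Icc_self hs)).trans (le_max_right R₁ R₂))
    have j1 := norm_toL2_field_sub_le κ γ g₁₁ g₁₂ i1 i2 i3 i4
    have j2 := norm_toL2_field_sub_le κ (-γ) g₂₂ g₁₂ i2 i1 i4 i3
    rw [abs_neg] at j2
    have ha : 0 ≤ a s := norm_nonneg _
    have hb : 0 ≤ b s := norm_nonneg _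
    have k1 : |κ| + |γ| + 27 * R ^ 2 * (|g₁₁| + |g₁₂|) ≤ C := by
      rw [hC]
      gcongr
      linarith [abs_nonneg g₂₂]
    have k2 : |κ| + |γ| + 27 * R ^ 2 * (|g₂₂| + |g₁₂|) ≤ C := by
      rw [hC]
      gcongr
      linarith [abs_nonneg g₁₁]
    have l1 := j1.trans (mul_le_mul_of_nonneg_right k1 (add_nonneg ha hb))
    have l2 := j2.trans (mul_le_mul_of_nonneg_right k2 (add_nonneg hb ha))
    have m1 := (hb₁ s).trans (mul_le_mul_of_nonneg_left
      (mul_le_mul_of_nonneg_right l1 ha) zero_le_two)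
    have m2 := (hb₂ s).trans (mul_le_mul_of_nonneg_left
      (mul_le_mul_of_nonneg_right l2 hb) zero_le_two)
    have m3 := abs_add_le (y₁ s) (y₂ s)
    -- The two bounds add up to 2C (a + b)², which is at most 4C (a² + b²).
    have m4 : 0 ≤ C * (a s - b s) ^ 2 := by positivity
    nlinarith
  have h := le_mul_exp_of_abs_deriv_le (fun s _ => hY s) hle
    (t := t) (abs_lt.1 (by rw [hT]; linarith))
  have a0 : a 0 = 0 := by simp [a, h0]
  have b0 : b 0 = 0 := by simp [b, h0]
  simp only [a0, b0] at h
  have ha : a t = 0 := by nlinarith [sq_nonneg (a t), sq_nonneg (b t)]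
  have hb : b t = 0 := by nlinarith [sq_nonneg (a t), sq_nonneg (b t)]
  rw [norm_eq_zero] at ha hb
  rw [map_sub, sub_eq_zero] at ha hb
  exact Prod.ext (toL2_injective ha) (toL2_injective hb)

end PTNLS
end

/-! ### The modified energy and its growth. -/

noncomputable section

namespace PTNLS

open Filter Topology Set Metric
open scoped NNReal

/-- The total mass. -/
def mass (w : H1 × H1) : ℝ := ‖toL2 w.1‖ ^ 2 + ‖toL2 w.2‖ ^ 2

/-- The kinetic energy. -/
def kinetic (w : H1 × H1) : ℝ := ‖dx w.1‖ ^ 2 + ‖dx w.2‖ ^ 2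

/-- The quartic part `∫ ½ g₁₁ |u|⁴ + ½ g₂₂ |v|⁴ + g₁₂ |u|² |v|²` of the energy. -/
def quartic (g₁₁ g₂₂ g₁₂ : ℝ) (w : H1 × H1) : ℝ :=
  g₁₁ / 2 * (ι (mul w.1 (conj w.1)) (mul w.1 (conj w.1))).re
    + g₂₂ / 2 * (ι (mul w.2 (conj w.2)) (mul w.2 (conj w.2))).re
    + g₁₂ * (ι (mul w.1 (conj w.1)) (mul w.2 (conj w.2))).re

/-- A coercive combination of the energy and the mass. -/
def energy (g₁₁ g₂₂ g₁₂ : ℝ) (w : H1 × H1) : ℝ :=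
  mass w + kinetic w - quartic g₁₁ g₂₂ g₁₂ w
    + (2 * (|g₁₁| + |g₂₂| + |g₁₂|) ^ 2 + 1) * mass w ^ 3

theorem conj_density (u : H1) : conj (mul u (conj u)) = mul u (conj u) := by
  rw [conj_mul, conj_conj', mul_comm']

theorem conj_potential (a b : ℝ) (u v : H1) : conj (potential a b u v) = potential a b u v := by
  rw [potential, map_add, conj_smul, conj_smul, conj_density, conj_density, Complex.conj_ofReal,
    Complex.conj_ofReal]

/-- Pairing the derivative of `|u|²` with a function. -/
theorem hasDerivAt_density {u : ℝ → H1} {u' : HNeg1} {t : ℝ}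
    (hu : HasDerivAt (fun s => ι (u s)) u' t) (hc : ContinuousAt u t) :
    ∃ p' : HNeg1, HasDerivAt (fun s => ι (mul (u s) (conj (u s)))) p' t ∧
      ∀ q, conj q = q → (p' q).re = 2 * (u' (mul (conj (u t)) q)).re := by
  refine ⟨_, hasDerivAt_ι_mul hu (hasDerivAt_ι_conj hu)
    (conj.continuous.continuousAt.comp hc), fun q hq => ?_⟩
  rw [add_apply, ContinuousLinearMap.comp_apply, ContinuousLinearMap.comp_apply, conjDual_apply,
    conj_mul, hq, Complex.add_re, Complex.conj_re]
  ring

/-- The potentials are the derivatives of the quartic density in |u|² and |v|²; the shared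
coefficient g₁₂ is what makes both arise from one density. -/
theorem hasDerivAt_quartic (g₁₁ g₂₂ g₁₂ : ℝ) {w : ℝ → H1 × H1} {u' v' : HNeg1} {t : ℝ}
    (hu : HasDerivAt (fun s => ι (w s).1) u' t) (hv : HasDerivAt (fun s => ι (w s).2) v' t)
    (hc : ContinuousAt w t) :
    HasDerivAt (fun s => quartic g₁₁ g₂₂ g₁₂ (w s))
      (2 * (u' (mul (conj (w t).1) (potential g₁₁ g₁₂ (w t).1 (w t).2))).re
        + 2 * (v' (mul (conj (w t).2) (potential g₂₂ g₁₂ (w t).2 (w t).1))).re) t := by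
  have hcu : ContinuousAt (fun s => (w s).1) t := continuous_fst.continuousAt.comp hc
  have hcv : ContinuousAt (fun s => (w s).2) t := continuous_snd.continuousAt.comp hc
  have hcd {x : ℝ → H1} (hx : ContinuousAt x t) : ContinuousAt (fun s => mul (x s) (conj (x s))) t := by
    have : Continuous fun f : H1 => mul f (conj f) := by fun_prop
    exact this.continuousAt.comp hx
  obtain ⟨p', hp, hp'⟩ := hasDerivAt_density hu hcu
  obtain ⟨r', hr, hr'⟩ := hasDerivAt_density hv hcv
  have hre {c : ℝ → ℂ} {c' : ℂ} (h : HasDerivAt c c' t) : HasDerivAt (fun s => (c s).re) c'.re t :=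
    Complex.reCLM.hasFDerivAt.comp_hasDerivAt t h
  have h1 := hre (hasDerivAt_ι_apply hp hp (hcd hcu))
  have h2 := hre (hasDerivAt_ι_apply hr hr (hcd hcv))
  have h3 := hre (hasDerivAt_ι_apply hp hr (hcd hcv))
  have h := ((h1.const_mul (g₁₁ / 2)).add (h2.const_mul (g₂₂ / 2))).add (h3.const_mul g₁₂)
  rw [← hp' _ (conj_potential _ _ _ _), ← hr' _ (conj_potential _ _ _ _)]
  refine h.congr_deriv ?_
  simp only [potential, map_add, map_smul, smul_eq_mul, Complex.add_re, Complex.re_ofReal_mul]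
  ring

/-- The group commutes with ∂ₓ and preserves the L² norm, so the quantity equals ‖∂ₓz‖² and is
differentiable although S(t) z(t) itself is handled only in H⁻¹. -/
theorem hasDerivAt_norm_dx_sq {z : ℝ → H1} {z' : H1} {t : ℝ} (hz : HasDerivAt z z' t) :
    HasDerivAt (fun s => ‖dx (free s (z s))‖ ^ 2)
      (2 * (dform (conj (free t (z t))) (free t z')).re) t := by
  have h1 : HasDerivAt (fun s => dx (z s)) (dx z') t :=
    (dx.restrictScalars ℝ).hasFDerivAt.comp_hasDerivAt t hz
  have h2 := Complex.reCLM.hasFDerivAt.comp_hasDerivAt t (h1.inner ℂ h1)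
  have e : (fun s => ‖dx (free s (z s))‖ ^ 2) = fun s => (inner ℂ (dx (z s)) (dx (z s))).re := by
    funext s
    rw [dx_free, norm_freeL2, inner_self_eq_norm_sq_to_K, ← RCLike.ofReal_pow,
      RCLike.ofReal_eq_complex_ofReal, Complex.ofReal_re]
  rw [e]
  refine h2.congr_deriv ?_
  rw [dform_conj, dx_free, dx_free, inner_freeL2, Complex.reCLM_apply, Complex.add_re]
  have : (inner ℂ (dx z') (dx (z t))).re = (inner ℂ (dx (z t)) (dx z')).re :=
    inner_re_symm (𝕜 := ℂ) _ _
  rw [this]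
  ring

theorem re_I_mul_eq_zero {c : ℂ} (h : starRingEnd ℂ c = c) : (Complex.I * c).re = 0 := by
  have := Complex.conj_eq_iff_im.1 h
  simp [this]

/-- The potential ρ is real, so ∫ ρ |u|² is real and its multiple by i has no real part. -/
theorem re_ι_field_conj (κ γ a b : ℝ) (u v : H1) :
    (ι (field κ γ a b u v) (conj u)).re
      = (-Complex.I * κ * ι v (conj u)).re + γ * ‖toL2 u‖ ^ 2 := by
  have h : starRingEnd ℂ (ι (mul u (potential a b u v)) (conj u))
      = ι (mul u (potential a b u v)) (conj u) := by
    rw [conj_ι, conj_mul, conj_potential, conj_conj', ι_mul, ι_comm, mul_comm' _ u]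
  rw [field, norm_toL2_sq]
  simp only [map_add, map_smul, add_apply, smul_apply, smul_eq_mul, Complex.add_re,
    re_I_mul_eq_zero h, Complex.re_ofReal_mul]
  ring

theorem re_cross_ι (κ : ℝ) (u v : H1) :
    (-Complex.I * κ * ι v (conj u)).re + (-Complex.I * κ * ι u (conj v)).re = 0 := by
  have h : ι u (conj v) = starRingEnd ℂ (ι v (conj u)) := by
    rw [conj_ι, conj_conj', ι_comm]
  rw [h]
  simp

theorem re_dform_conj_field (κ γ a b : ℝ) (u v : H1) :
    (dform (conj u) (field κ γ a b u v)).re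
      = (-Complex.I * κ * dform (conj u) v).re + γ * ‖dx u‖ ^ 2
        + (Complex.I * dform (conj u) (mul u (potential a b u v))).re := by
  have h : dform (conj u) u = ((‖dx u‖ ^ 2 : ℝ) : ℂ) := by rw [dform_comm, dform_self_conj]
  rw [field]
  simp only [map_add, map_smul, smul_eq_mul, Complex.add_re, h, Complex.re_ofReal_mul,
    Complex.ofReal_re]

theorem re_cross_dform (κ : ℝ) (u v : H1) :
    (-Complex.I * κ * dform (conj u) v).re + (-Complex.I * κ * dform (conj v) u).re = 0 := by
  have h : dform (conj v) u = starRingEnd ℂ (dform (conj u) v) := by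
    rw [conj_dform, conj_conj', dform_comm]
  rw [h]
  simp

/-- This is the key cancellation: the dispersive part of the derivative of the quartic energy equals
the nonlinear term in the derivative of the kinetic energy, as found in `re_dform_conj_field`. -/
theorem re_schrodingerOp_conj_mul {ρ : H1} (hρ : conj ρ = ρ) (u : H1) :
    (schrodingerOp u (mul (conj u) ρ)).re = (Complex.I * dform (conj u) (mul u ρ)).re := by
  rw [schrodingerOp_apply, ← Complex.conj_re]
  rw [map_mul, conj_dform, conj_mul, conj_conj', hρ]
  simp

theorem re_ι_field_conj_mul (κ γ a b : ℝ) (u v : H1) :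
    (ι (field κ γ a b u v) (mul (conj u) (potential a b u v))).re
      = (-Complex.I * κ * ι v (mul (conj u) (potential a b u v))).re
        + γ * (ι u (mul (conj u) (potential a b u v))).re := by
  set ρ := potential a b u v with hρ
  have h : starRingEnd ℂ (ι (mul u ρ) (mul (conj u) ρ)) = ι (mul u ρ) (mul (conj u) ρ) := by
    rw [conj_ι, conj_mul, conj_mul, conj_conj', hρ, conj_potential, ι_comm]
  rw [field, ← hρ]
  simp only [map_add, map_smul, add_apply, smul_apply, smul_eq_mul, Complex.add_re,
    re_I_mul_eq_zero h, Complex.re_ofReal_mul]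
  ring

section Bounds

variable {q d : ℝ} {f g h : H1}

theorem norm_toLinf_le_sqrt (hq : ‖toL2 f‖ ≤ q) (hd : ‖dx f‖ ≤ d) : ‖toLinf f‖ ≤ √(2 * q * d) := by
  apply Real.le_sqrt_of_sq_le
  refine (norm_toLinf_sq_le f).trans ?_
  have : 0 ≤ q := (norm_nonneg _).trans hq
  gcongr

theorem norm_toL2_mul_le_sqrt (hf : ‖toL2 f‖ ≤ q) (hf' : ‖dx f‖ ≤ d) (hg : ‖toL2 g‖ ≤ q) :
    ‖toL2 (mul f g)‖ ≤ √(2 * q * d) * q :=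
  (norm_toL2_mul_le f g).trans (mul_le_mul (norm_toLinf_le_sqrt hf hf') hg (norm_nonneg _)
    (Real.sqrt_nonneg _))

/-- Two factors are taken in the sup norm, each costing √(2qd), and one in L². The result is only
linear in d, so d² can absorb it. -/
theorem norm_toL2_mul_mul_le (hf : ‖toL2 f‖ ≤ q) (hf' : ‖dx f‖ ≤ d) (hg : ‖toL2 g‖ ≤ q)
    (hg' : ‖dx g‖ ≤ d) (hh : ‖toL2 h‖ ≤ q) :
    ‖toL2 (mul f (mul g h))‖ ≤ 2 * q ^ 2 * d := by
  have hq : 0 ≤ q := (norm_nonneg _).trans hf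
  have hd : 0 ≤ d := (norm_nonneg _).trans hf'
  calc ‖toL2 (mul f (mul g h))‖ ≤ √(2 * q * d) * (√(2 * q * d) * q) :=
        (norm_toL2_mul_le _ _).trans (mul_le_mul (norm_toLinf_le_sqrt hf hf')
          (norm_toL2_mul_le_sqrt hg hg' hh) (norm_nonneg _) (Real.sqrt_nonneg _))
    _ = √(2 * q * d) ^ 2 * q := by ring
    _ = 2 * q ^ 2 * d := by rw [Real.sq_sqrt (by positivity)]; ring

theorem norm_toL2_conj_mul_potential_le {a b : ℝ} {u v : H1} (hu : ‖toL2 u‖ ≤ q) (hu' : ‖dx u‖ ≤ d)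
    (hv : ‖toL2 v‖ ≤ q) (hv' : ‖dx v‖ ≤ d) :
    ‖toL2 (mul (conj u) (potential a b u v))‖ ≤ (|a| + |b|) * (2 * q ^ 2 * d) := by
  have i1 : ‖toL2 (conj u)‖ ≤ q := by rwa [toL2_conj, norm_conjL2]
  have i2 : ‖dx (conj u)‖ ≤ d := by rwa [dx_conj, norm_conjL2]
  have i3 : ‖toL2 (conj v)‖ ≤ q := by rwa [toL2_conj, norm_conjL2]
  rw [potential]
  simp only [map_add, map_smul]
  refine (norm_add_le _ _).trans ?_
  rw [norm_smul, norm_smul, Complex.norm_real, Complex.norm_real, Real.norm_eq_abs,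
    Real.norm_eq_abs, add_mul]
  gcongr
  · exact norm_toL2_mul_mul_le i1 i2 hu hu' i1
  · exact norm_toL2_mul_mul_le i1 i2 hv hv' i3

theorem abs_re_ι_density_le {u v : H1} (hu : ‖toL2 u‖ ≤ q) (hu' : ‖dx u‖ ≤ d)
    (hv : ‖toL2 v‖ ≤ q) (hv' : ‖dx v‖ ≤ d) :
    |(ι (mul u (conj u)) (mul v (conj v))).re| ≤ 2 * q ^ 3 * d := by
  have hq : 0 ≤ q := (norm_nonneg _).trans hu
  have hd : 0 ≤ d := (norm_nonneg _).trans hu'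
  have i1 : ‖toL2 (conj u)‖ ≤ q := by rwa [toL2_conj, norm_conjL2]
  have i3 : ‖toL2 (conj v)‖ ≤ q := by rwa [toL2_conj, norm_conjL2]
  calc _ ≤ (√(2 * q * d) * q) * (√(2 * q * d) * q) :=
        (Complex.abs_re_le_norm _).trans ((norm_ι_le _ _).trans
          (mul_le_mul (norm_toL2_mul_le_sqrt hu hu' i1) (norm_toL2_mul_le_sqrt hv hv' i3)
            (norm_nonneg _) (by positivity)))
    _ = √(2 * q * d) ^ 2 * q ^ 2 := by ring
    _ = 2 * q ^ 3 * d := by rw [Real.sq_sqrt (by positivity)]; ring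

theorem abs_re_ι_field_conj_mul_le {κ γ a b : ℝ} {u v : H1} (hu : ‖toL2 u‖ ≤ q) (hu' : ‖dx u‖ ≤ d)
    (hv : ‖toL2 v‖ ≤ q) (hv' : ‖dx v‖ ≤ d) :
    |(ι (field κ γ a b u v) (mul (conj u) (potential a b u v))).re|
      ≤ (|κ| + |γ|) * (|a| + |b|) * (2 * q ^ 3 * d) := by
  have hq : 0 ≤ q := (norm_nonneg _).trans hu
  have hd : 0 ≤ d := (norm_nonneg _).trans hu'
  have h0 := norm_toL2_conj_mul_potential_le (a := a) (b := b) hu hu' hv hv'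
  have h1 {f : H1} (hf : ‖toL2 f‖ ≤ q) : ‖ι f (mul (conj u) (potential a b u v))‖
      ≤ q * ((|a| + |b|) * (2 * q ^ 2 * d)) :=
    (norm_ι_le _ _).trans (mul_le_mul hf h0 (norm_nonneg _) hq)
  rw [re_ι_field_conj_mul]
  refine (abs_add_le _ _).trans ?_
  have h2 := (Complex.abs_re_le_norm (-Complex.I * κ * ι v (mul (conj u) (potential a b u v))))
  rw [norm_mul, norm_mul, norm_neg, Complex.norm_I, one_mul, Complex.norm_real,
    Real.norm_eq_abs] at h2
  have h3 := h2.trans (mul_le_mul_of_nonneg_left (h1 hv) (abs_nonneg κ))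
  have h4 := mul_le_mul_of_nonneg_left ((Complex.abs_re_le_norm _).trans (h1 hu)) (abs_nonneg γ)
  rw [abs_mul]
  calc _ ≤ _ := add_le_add h3 h4
    _ = _ := by ring

end Bounds

theorem mass_nonneg (w : H1 × H1) : 0 ≤ mass w := by unfold mass; positivity

theorem kinetic_nonneg (w : H1 × H1) : 0 ≤ kinetic w := by unfold kinetic; positivity

theorem norm_bounds (w : H1 × H1) : (‖toL2 w.1‖ ≤ √(mass w) ∧ ‖dx w.1‖ ≤ √(kinetic w)) ∧
    ‖toL2 w.2‖ ≤ √(mass w) ∧ ‖dx w.2‖ ≤ √(kinetic w) := by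
  refine ⟨⟨?_, ?_⟩, ?_, ?_⟩ <;> apply Real.le_sqrt_of_sq_le <;> simp only [mass, kinetic]
  · linarith [sq_nonneg ‖toL2 w.2‖]
  · linarith [sq_nonneg ‖dx w.2‖]
  · linarith [sq_nonneg ‖toL2 w.1‖]
  · linarith [sq_nonneg ‖dx w.1‖]

/-- The energy is coercive. -/
theorem le_energy (g₁₁ g₂₂ g₁₂ : ℝ) (w : H1 × H1) :
    mass w + kinetic w / 2 + mass w ^ 3 ≤ energy g₁₁ g₂₂ g₁₂ w := by
  obtain ⟨⟨hu, hu'⟩, hv, hv'⟩ := norm_bounds w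
  set q := √(mass w)
  set d := √(kinetic w)
  set G := |g₁₁| + |g₂₂| + |g₁₂| with hG
  have hq2 : q ^ 2 = mass w := Real.sq_sqrt (mass_nonneg w)
  have hd2 : d ^ 2 = kinetic w := Real.sq_sqrt (kinetic_nonneg w)
  have hq : 0 ≤ q := Real.sqrt_nonneg _
  have hd : 0 ≤ d := Real.sqrt_nonneg _
  have hP : quartic g₁₁ g₂₂ g₁₂ w ≤ G * (2 * q ^ 3 * d) := by
    have h1 := abs_re_ι_density_le hu hu' hu hu'
    have h2 := abs_re_ι_density_le hv hv' hv hv'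
    have h3 := abs_re_ι_density_le hu hu' hv hv'
    have m (g x : ℝ) (hx : |x| ≤ 2 * q ^ 3 * d) : g * x ≤ |g| * (2 * q ^ 3 * d) := by
      refine (le_abs_self _).trans ?_
      rw [abs_mul]
      gcongr
    have m1 := m (g₁₁ / 2) _ h1
    have m2 := m (g₂₂ / 2) _ h2
    have m3 := m g₁₂ _ h3
    rw [abs_div, abs_two] at m1 m2
    have n1 : 0 ≤ |g₁₁| * (2 * q ^ 3 * d) := by positivity
    have n2 : 0 ≤ |g₂₂| * (2 * q ^ 3 * d) := by positivity
    rw [quartic, hG]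
    linarith
  have hY : G * (2 * q ^ 3 * d) ≤ d ^ 2 / 2 + 2 * G ^ 2 * (q ^ 2) ^ 3 := by
    -- This square dictates the coefficient 2G² of M³ in the energy; the extra 1 there leaves M³ on
    -- the coercive side.
    nlinarith [sq_nonneg (d - 2 * G * q ^ 3)]
  rw [energy, ← hG, ← hq2, ← hd2]
  linarith

/-- The growth rate of the energy. -/
def growthRate (κ γ g₁₁ g₂₂ g₁₂ : ℝ) : ℝ :=
  2 * (2 * |γ| + 8 * ((|κ| + |γ|) * (|g₁₁| + |g₂₂| + |g₁₂|))
    + 6 * (2 * (|g₁₁| + |g₂₂| + |g₁₂|) ^ 2 + 1) * |γ|)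

theorem growthRate_nonneg (κ γ g₁₁ g₂₂ g₁₂ : ℝ) : 0 ≤ growthRate κ γ g₁₁ g₂₂ g₁₂ := by
  unfold growthRate
  positivity

/-- A solution in the interaction picture solves the system in `H⁻¹`. -/
theorem hasDerivAt_ι_freePair {κ γ g₁₁ g₂₂ g₁₂ : ℝ} {z : ℝ → H1 × H1} {t : ℝ}
    (hz : HasDerivAt z (interactionField κ γ g₁₁ g₂₂ g₁₂ t (z t)) t) :
    HasDerivAt (fun s => ι (freePair s (z s)).1) (schrodingerOp (freePair t (z t)).1
      + ι (fieldPair κ γ g₁₁ g₂₂ g₁₂ (freePair t (z t))).1) t ∧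
    HasDerivAt (fun s => ι (freePair s (z s)).2) (schrodingerOp (freePair t (z t)).2
      + ι (fieldPair κ γ g₁₁ g₂₂ g₁₂ (freePair t (z t))).2) t := by
  have h1 := hasDerivAt_ι_free_comp hz.fst
  have h2 := hasDerivAt_ι_free_comp hz.snd
  simp only [interactionField] at h1 h2
  rw [freePair, free_free_neg] at h1 h2
  exact ⟨h1, h2⟩

theorem hasDerivAt_kinetic {κ γ g₁₁ g₂₂ g₁₂ : ℝ} {z : ℝ → H1 × H1} {t : ℝ}
    (hz : HasDerivAt z (interactionField κ γ g₁₁ g₂₂ g₁₂ t (z t)) t) :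
    HasDerivAt (fun s => kinetic (freePair s (z s)))
      (2 * (dform (conj (freePair t (z t)).1) (fieldPair κ γ g₁₁ g₂₂ g₁₂ (freePair t (z t))).1).re
      + 2 * (dform (conj (freePair t (z t)).2)
        (fieldPair κ γ g₁₁ g₂₂ g₁₂ (freePair t (z t))).2).re) t := by
  have h1 := hasDerivAt_norm_dx_sq hz.fst
  have h2 := hasDerivAt_norm_dx_sq hz.snd
  simp only [interactionField] at h1 h2
  rw [freePair, free_free_neg] at h1 h2
  exact h1.add h2

/-- The energy estimate for solutions in the interaction picture. -/
theorem hasDerivAt_energy {κ γ g₁₁ g₂₂ g₁₂ : ℝ} {z : ℝ → H1 × H1} {t : ℝ}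
    (hz : HasDerivAt z (interactionField κ γ g₁₁ g₂₂ g₁₂ t (z t)) t) :
    ∃ y, HasDerivAt (fun s => energy g₁₁ g₂₂ g₁₂ (freePair s (z s))) y t ∧
      |y| ≤ growthRate κ γ g₁₁ g₂₂ g₁₂ * energy g₁₁ g₂₂ g₁₂ (freePair t (z t)) := by
  have hc : ContinuousAt (fun s => freePair s (z s)) t :=
    tendsto_freePair tendsto_id hz.continuousAt.tendsto
  obtain ⟨hu, hv⟩ := hasDerivAt_ι_freePair hz
  have hK := hasDerivAt_kinetic hz
  have hP := hasDerivAt_quartic g₁₁ g₂₂ g₁₂ hu hv hc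
  have hM := (hasDerivAt_norm_toL2_sq hu (continuous_fst.continuousAt.comp hc)).add
    (hasDerivAt_norm_toL2_sq hv (continuous_snd.continuousAt.comp hc))
  have hM' : HasDerivAt (fun s => mass (freePair s (z s))) _ t := hM
  refine ⟨_, ((hM'.add hK).sub hP).add ((hM'.pow 3).const_mul _), ?_⟩
  have hE := le_energy g₁₁ g₂₂ g₁₂ (freePair t (z t))
  generalize energy g₁₁ g₂₂ g₁₂ (freePair t (z t)) = Z at hE ⊢
  generalize freePair t (z t) = w at hE ⊢
  obtain ⟨⟨bu, bu'⟩, bv, bv'⟩ := norm_bounds w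
  have hQ := mass_nonneg w
  have hD := kinetic_nonneg w
  have hq2 := Real.sq_sqrt hQ
  have hd2 := Real.sq_sqrt hD
  have hq : 0 ≤ √(mass w) := Real.sqrt_nonneg _
  have hd : 0 ≤ √(kinetic w) := Real.sqrt_nonneg _
  have e1 := abs_re_ι_field_conj_mul_le (κ := κ) (γ := γ) (a := g₁₁) (b := g₁₂) bu bu' bv bv'
  have e2 := abs_re_ι_field_conj_mul_le (κ := κ) (γ := -γ) (a := g₂₂) (b := g₁₂) bv bv' bu bu'
  have c1 := re_cross_ι κ w.1 w.2
  have c2 := re_cross_dform κ w.1 w.2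
  simp only [fieldPair, add_apply, Complex.add_re, re_schrodingerOp_self, re_ι_field_conj,
    re_dform_conj_field, re_schrodingerOp_conj_mul (conj_potential _ _ _ _), zero_add]
  rw [abs_neg] at e2
  generalize (ι (field κ γ g₁₁ g₁₂ w.1 w.2)
    (mul (conj w.1) (potential g₁₁ g₁₂ w.1 w.2))).re = X at e1 ⊢
  generalize (ι (field κ (-γ) g₂₂ g₁₂ w.2 w.1)
    (mul (conj w.2) (potential g₂₂ g₁₂ w.2 w.1))).re = Y at e2 ⊢
  generalize (-Complex.I * κ * ι w.2 (conj w.1)).re = c₁ at c1 ⊢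
  generalize (-Complex.I * κ * ι w.1 (conj w.2)).re = c₂ at c1 ⊢
  generalize (-Complex.I * κ * dform (conj w.1) w.2).re = d₁ at c2 ⊢
  generalize (-Complex.I * κ * dform (conj w.2) w.1).re = d₂ at c2 ⊢
  set q := √(mass w)
  set d := √(kinetic w)
  set G := |g₁₁| + |g₂₂| + |g₁₂| with hG
  have hQdef : mass w = ‖toL2 w.1‖ ^ 2 + ‖toL2 w.2‖ ^ 2 := rfl
  have hDdef : kinetic w = ‖dx w.1‖ ^ 2 + ‖dx w.2‖ ^ 2 := rfl
  set M := mass w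
  set D := kinetic w
  set m := γ * (‖toL2 w.1‖ ^ 2 - ‖toL2 w.2‖ ^ 2) with hm
  set k := γ * (‖dx w.1‖ ^ 2 - ‖dx w.2‖ ^ 2) with hk
  have hmle : |m| ≤ |γ| * M := by
    rw [hm, abs_mul, hQdef]
    gcongr
    rw [abs_le]
    constructor <;> linarith [sq_nonneg ‖toL2 w.1‖, sq_nonneg ‖toL2 w.2‖]
  have hkle : |k| ≤ |γ| * D := by
    rw [hk, abs_mul, hDdef]
    gcongr
    rw [abs_le]
    constructor <;> linarith [sq_nonneg ‖dx w.1‖, sq_nonneg ‖dx w.2‖]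
  set A := |κ| + |γ| with hA
  have hA0 : 0 ≤ A := by positivity
  have hG0 : 0 ≤ G := by positivity
  -- Since q⁶ = M³ and d² = D, Young's inequality bounds the nonlinear remainder linearly by
  -- quantities the energy controls.
  have hqd : 2 * q ^ 3 * d ≤ M ^ 3 + D := by
    rw [← hq2, ← hd2]
    nlinarith [sq_nonneg (q ^ 3 - d)]
  have hX : |X| ≤ A * G * (M ^ 3 + D) := by
    refine e1.trans ?_
    gcongr
    rw [hG]
    linarith [abs_nonneg g₂₂]
  have hY : |Y| ≤ A * G * (M ^ 3 + D) := by
    refine e2.trans ?_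
    gcongr
    rw [hG]
    linarith [abs_nonneg g₁₁]
  have habs : |2 * m + 2 * k - 2 * X - 2 * Y + (2 * G ^ 2 + 1) * (3 * M ^ 2 * (2 * m))|
      ≤ 2 * (|γ| * M) + 2 * (|γ| * D) + 4 * (A * G * (M ^ 3 + D))
        + (2 * G ^ 2 + 1) * (3 * M ^ 2 * (2 * (|γ| * M))) := by
    have hm' : |(2 * G ^ 2 + 1) * (3 * M ^ 2 * (2 * m))|
        ≤ (2 * G ^ 2 + 1) * (3 * M ^ 2 * (2 * (|γ| * M))) := by
      rw [abs_mul, abs_mul (3 * M ^ 2), abs_mul 2 m, abs_of_nonneg (by positivity : 0 ≤ 2 * G ^ 2 + 1),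
        abs_of_nonneg (by positivity : 0 ≤ 3 * M ^ 2), abs_two]
      gcongr
    rw [abs_le] at hm' hmle hkle hX hY ⊢
    constructor <;> linarith [hm'.1, hm'.2, hmle.1, hmle.2, hkle.1, hkle.2, hX.1, hX.2, hY.1, hY.2]
  refine le_trans (le_of_eq ?_) (habs.trans ?_)
  · congr 1
    rw [hm, hk]
    norm_num
    -- The mass coupling `c1` enters through M and through M³, the kinetic coupling `c2` once; the
    -- dispersive terms cancel identically.
    linear_combination (2 + (2 * G ^ 2 + 1) * 6 * M ^ 2) * c1 + 2 * c2
  · have hK0 := growthRate_nonneg κ γ g₁₁ g₂₂ g₁₂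
    refine le_trans ?_ (mul_le_mul_of_nonneg_left hE hK0)
    -- The outer factor 2 in the rate compensates for the coefficient 1/2 of the kinetic energy in
    -- the coercivity bound.
    rw [growthRate, ← hG, ← hA]
    have p1 : 0 ≤ |γ| * M := by positivity
    have p2 : 0 ≤ |γ| * D := by positivity
    have p3 : 0 ≤ A * G * M := by positivity
    have p4 : 0 ≤ A * G * D := by positivity
    have p5 : 0 ≤ A * G * M ^ 3 := by positivity
    have p6 : 0 ≤ (2 * G ^ 2 + 1) * |γ| * M := by positivity
    have p7 : 0 ≤ (2 * G ^ 2 + 1) * |γ| * D := by positivity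
    have p8 : 0 ≤ (2 * G ^ 2 + 1) * |γ| * M ^ 3 := by positivity
    have p9 : 0 ≤ |γ| * M ^ 3 := by positivity
    linarith

theorem norm_sq_le_energy (g₁₁ g₂₂ g₁₂ : ℝ) (w : H1 × H1) :
    ‖w‖ ^ 2 ≤ 2 * energy g₁₁ g₂₂ g₁₂ w := by
  have h := le_energy g₁₁ g₂₂ g₁₂ w
  have h3 : 0 ≤ mass w ^ 3 := pow_nonneg (mass_nonneg w) 3
  have hM := mass_nonneg w
  refine le_trans ?_ (by linarith : mass w + kinetic w ≤ _)
  have h1 := H1.norm_sq_eq w.1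
  have h2 := H1.norm_sq_eq w.2
  rw [mass, kinetic]
  rcases max_choice ‖w.1‖ ‖w.2‖ with h | h <;> rw [Prod.norm_def, h]
  · linarith [sq_nonneg ‖w.2‖]
  · linarith [sq_nonneg ‖w.1‖]

/-! ### The a priori bound and global existence. -/

/-- The a priori bound for the solution with initial value `w₀`. -/
def aprioriBound (κ γ g₁₁ g₂₂ g₁₂ : ℝ) (w₀ : H1 × H1) (t : ℝ) : ℝ :=
  √(2 * energy g₁₁ g₂₂ g₁₂ w₀) * Real.exp (growthRate κ γ g₁₁ g₂₂ g₁₂ / 2 * t)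

theorem monotone_aprioriBound (κ γ g₁₁ g₂₂ g₁₂ : ℝ) (w₀ : H1 × H1) :
    Monotone (aprioriBound κ γ g₁₁ g₂₂ g₁₂ w₀) := by
  intro s t hst
  have := growthRate_nonneg κ γ g₁₁ g₂₂ g₁₂
  unfold aprioriBound
  gcongr

theorem freePair_zero (w : H1 × H1) : freePair 0 w = w := by
  rw [freePair, free_zero, free_zero]

/-- Grönwall applied to the energy; it controls the squared norm, hence the halved exponent. -/
theorem norm_le_aprioriBound {κ γ g₁₁ g₂₂ g₁₂ : ℝ} {w₀ : H1 × H1} {T : ℝ} {z : ℝ → H1 × H1}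
    (hz0 : z 0 = w₀)
    (hz : ∀ t ∈ Ioo (-T) T, HasDerivAt z (interactionField κ γ g₁₁ g₂₂ g₁₂ t (z t)) t) {t : ℝ}
    (ht : t ∈ Ioo (-T) T) : ‖z t‖ ≤ aprioriBound κ γ g₁₁ g₂₂ g₁₂ w₀ |t| := by
  choose! y hy hle using fun t ht => hasDerivAt_energy (hz t ht)
  have h := le_mul_exp_of_abs_deriv_le hy hle ht
  have h2 := norm_sq_le_energy g₁₁ g₂₂ g₁₂ (freePair t (z t))
  rw [norm_freePair] at h2
  rw [freePair_zero, hz0] at h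
  rw [aprioriBound]
  have hE : 0 ≤ 2 * energy g₁₁ g₂₂ g₁₂ w₀ := (sq_nonneg _).trans (norm_sq_le_energy _ _ _ w₀)
  apply le_of_sq_le_sq _ (by positivity)
  rw [mul_pow, Real.sq_sqrt hE, ← Real.exp_nat_mul]
  have e : ((2 : ℕ) : ℝ) * (growthRate κ γ g₁₁ g₂₂ g₁₂ / 2 * |t|)
      = growthRate κ γ g₁₁ g₂₂ g₁₂ * |t| := by
    push_cast
    ring
  rw [e]
  linarith

theorem exists_globalSolution (κ γ g₁₁ g₂₂ g₁₂ : ℝ) (w₀ : H1 × H1) :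
    ∃ w : C(ℝ, H1 × H1), IsGlobalSolution κ γ g₁₁ g₂₂ g₁₂ w ∧ w 0 = w₀ ∧
      ∀ t, ‖w t‖ ≤ aprioriBound κ γ g₁₁ g₂₂ g₁₂ w₀ |t| := by
  have hL0 (R : ℝ) : 0 ≤ 2 * (|κ| + |γ| + 27 * R ^ 2 * (|g₁₁| + |g₂₂| + |g₁₂|)) := by positivity
  obtain ⟨z, hz0, hz⟩ := exists_global_solution (f := interactionField κ γ g₁₁ g₂₂ g₁₂) (x₀ := w₀)
    (B := aprioriBound κ γ g₁₁ g₂₂ g₁₂ w₀)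
    (fun R => ⟨⟨_, hL0 R⟩, fun t => LipschitzOnWith.of_dist_le_mul fun x hx y hy => by
      rw [dist_eq_norm, dist_eq_norm]
      exact norm_interactionField_sub_le _ _ _ _ _ _ (mem_closedBall_zero_iff.1 hx)
        (mem_closedBall_zero_iff.1 hy)⟩)
    (fun R => by
      rcases lt_or_ge R 0 with hR | hR
      · exact ⟨0, fun t x hx => absurd (norm_nonneg x)
          (not_le.2 ((mem_closedBall_zero_iff.1 hx).trans_lt hR))⟩
      refine ⟨⟨_, mul_nonneg (hL0 R) hR⟩, fun t x hx => ?_⟩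
      have hx' := mem_closedBall_zero_iff.1 hx
      have h := norm_interactionField_sub_le κ γ g₁₁ g₂₂ g₁₂ t hx' ((norm_zero (E := H1 × H1)).trans_le hR)
      rw [interactionField_zero, sub_zero, sub_zero] at h
      exact h.trans (mul_le_mul_of_nonneg_left hx' (hL0 R)))
    (continuous_interactionField κ γ g₁₁ g₂₂ g₁₂) (monotone_aprioriBound _ _ _ _ _ _)
    (by
      rw [aprioriBound, mul_zero, Real.exp_zero, mul_one]
      exact Real.le_sqrt_of_sq_le (norm_sq_le_energy _ _ _ _))
    (fun T _ z hz0 hz t ht => norm_le_aprioriBound hz0 hz ht)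
  refine ⟨⟨fun t => freePair t (z t), continuous_iff_continuousAt.2 fun t =>
    tendsto_freePair tendsto_id (hz t).continuousAt.tendsto⟩, ?_, ?_, fun t => ?_⟩
  · rw [isGlobalSolution_iff]
    exact fun t => hasDerivAt_ι_freePair (hz t)
  · simp [hz0, freePair_zero]
  · change ‖freePair t (z t)‖ ≤ _
    rw [norm_freePair]
    exact norm_le_aprioriBound (T := |t| + 1) hz0 (fun s _ => hz s) (abs_lt.1 (by linarith))

end PTNLS
end

theorem theorem1 (κ γ g₁₁ g₂₂ g₁₂ : ℝ) (hκ : 0 ≤ κ) (hγ : 0 ≤ γ) :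
    (∀ u₀ v₀ : PTNLS.H1, ∃! w : C(ℝ, PTNLS.H1 × PTNLS.H1),
      PTNLS.IsGlobalSolution κ γ g₁₁ g₂₂ g₁₂ w ∧ w 0 = (u₀, v₀)) ∧
    (∃ a : ℝ, 0 ≤ a ∧ ∀ w : C(ℝ, PTNLS.H1 × PTNLS.H1),
      PTNLS.IsGlobalSolution κ γ g₁₁ g₂₂ g₁₂ w →
      ∃ C : ℝ, ∀ t : ℝ, ‖(w t).1‖ + ‖(w t).2‖ ≤ C * Real.exp (a * |t|)) := by
  refine ⟨fun u₀ v₀ => ?_, PTNLS.growthRate κ γ g₁₁ g₂₂ g₁₂ / 2, ?_, fun w hw => ?_⟩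
  · obtain ⟨w, hw, h0, -⟩ := PTNLS.exists_globalSolution κ γ g₁₁ g₂₂ g₁₂ (u₀, v₀)
    exact ⟨w, ⟨hw, h0⟩, fun w' hw' => PTNLS.solution_unique hw'.1 hw (hw'.2.trans h0.symm)⟩
  · exact div_nonneg (PTNLS.growthRate_nonneg _ _ _ _ _) zero_le_two
  · obtain ⟨w', hw', h0, hb⟩ := PTNLS.exists_globalSolution κ γ g₁₁ g₂₂ g₁₂ (w 0)
    -- An arbitrary solution coincides with the constructed one, for which the bound is known; the
    -- constant then doubles to cover both components.
    obtain rfl := PTNLS.solution_unique hw hw' h0.symm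
    refine ⟨2 * √(2 * PTNLS.energy g₁₁ g₂₂ g₁₂ (w 0)), fun t => ?_⟩
    have h1 := (norm_fst_le (w t)).trans (hb t)
    have h2 := (norm_snd_le (w t)).trans (hb t)
    rw [PTNLS.aprioriBound] at h1 h2
    linarith
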